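/- Let $I=[\xi,\eta]$ with $\xi<\eta$, and let $a:I\to\mathbb{R}$ satisfy $a\ge a_0>0$ on $I$. Let $G\subset\mathbb{C}$ be an open neighbourhood of $I$ to which $\sqrt a$ extends as a bounded analytic function (again written $\sqrt a$), so that also $a$ is analytic on $G$. Define two sequences of functions by $(S_0^{\pm})'=\pm i\sqrt a$ and $$(S_n)'=-\frac{1}{2S_0'}\Big(\sum_{j=1}^{n-1}S_j'S_{n-j}'+S_{n-1}''\Big)\quad(n\ge 1),\qquad S_n^{\pm}(x)=\int_\xi^x (S_n^{\pm})'(\tau)\,d\tau\quad (n\ge 0),$$ and put $M=\|S_0'\|_{L^\infty(G)}$. For $\varepsilon>0$ and $\varphi_0,\varphi_1\in\mathbb{C}$ let $\varphi$ be the solution of $$\varepsilon^2\varphi''+a\varphi=0 \text{ on } I,\qquad \varphi(\xi)=\varphi_0,\quad \varepsilon\varphi'(\xi)=\varphi_1 ,$$ and for $N\in\mathbb{N}_0$ let $$\varphi_N^{WKB}=\alpha_{N,\varepsilon}\exp\Big(\sum_{n=0}^N\varepsilon^{n-1}S_n^-\Big)+\beta_{N,\varepsilon}\exp\Big(\sum_{n=0}^N\varepsilon^{n-1}S_n^+\Big),$$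 $$\alpha_{N,\varepsilon}=\frac{\varphi_0\sum_{n=0}^N\varepsilon^n(S_n^+)'(\xi)-\varphi_1}{\sum_{n=0}^N\varepsilon^n\big((S_n^+)'(\xi)-(S_n^-)'(\xi)\big)},\qquad \beta_{N,\varepsilon}=\frac{\varphi_1-\varphi_0\sum_{n=0}^N\varepsilon^n(S_n^-)'(\xi)}{\sum_{n=0}^N\varepsilon^n\big((S_n^+)'(\xi)-(S_n^-)'(\xi)\big)} .$$ (With $0^0=1$.) There exist constants $K_1,K_2>0$, depending only on $I$, $G$ and $S_0'$, such that for both sequences $$\|S_n\|_{L^\infty(I)}\le(\eta-\xi)MK_2^nn^n\ (n\ge 0),\qquad \|S_n^{(k)}\|_{L^\infty(I)}\le M(k-1)!\,K_1^{k-1}K_2^nn^n\ (n\ge 0,\ k\ge 1).$$ For all such constants $K_1,K_2$ there exist a constant $C>0$, independent of $N$, $\varepsilon$, $\varphi_0$, $\varphi_1$, and numbers $\varepsilon_0(N)\in(0,1)$, independent of $\varphi_0,\varphi_1$ and satisfying $\varepsilon_0(N)\ge c/(N+1)$ with some $c>0$ independent of $N$, such that for all $N\ge 0$ and $\varepsilon\in(0,\varepsilon_0(N)]$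 the denominator of $\alpha_{N,\varepsilon}$ and $\beta_{N,\varepsilon}$ does not vanish and $$\|\varphi-\varphi_N^{WKB}\|_{L^\infty(I)}\le CM^2\Big(|\varphi_0|M\sum_{n=0}^N\varepsilon^nK_2^nn^n+|\varphi_1|\Big)\exp\Big((\eta-\xi)M\sum_{n=0}^{\lfloor N/2\rfloor}\varepsilon^{2n}K_2^{2n+1}(2n+1)^{2n+1}\Big)$$ $$\qquad\cdot\Big(2\varepsilon^NK_2^{N+1}(N+1)^{N+1}+\sum_{n=2}^N\varepsilon^{N+n-1}K_2^{N+n}\sum_{k=2}^{N+n}k^k(N+n-k)^{N+n-k}\Big).$$ In particular, for fixed $\varphi_0,\varphi_1$ and each fixed $N$, $\|\varphi-\varphi_N^{WKB}\|_{L^\infty(I)}=\mathcal{O}(\varepsilon^N)$ as $\varepsilon\to0$. -/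

import Mathlib

open MeasureTheory
open scoped ENNReal

namespace WKB

noncomputable section

/-- The `L^∞` norm over a set `s` (essential supremum with respect to Lebesgue measure),
as an extended nonnegative real. -/
def LInf {X : Type*} [MeasureSpace X] (s : Set X) (f : X → ℂ) : ℝ≥0∞ :=
  eLpNorm f ∞ (volume.restrict s)

/-- `dS s₀ n` is the function `S_n'` of the WKB recursion started at `S_0' = s₀`, on the complex
domain where `s₀` is analytic and nonzero. On the real interval the complex derivative of an
analytic function is its real derivative. -/
def dS (s₀ : ℂ → ℂ) : ℕ → ℂ → ℂ
  | 0 => s₀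
  | n + 1 => fun z =>
      -(1 / (2 * s₀ z)) *
        ((∑ j : Fin n, dS s₀ (j + 1) z * dS s₀ (n - j) z) + deriv (dS s₀ n) z)
termination_by n => n
decreasing_by all_goals omega

theorem dS_zero (s₀ : ℂ → ℂ) : dS s₀ 0 = s₀ := by
  rw [dS]

/-- The recursion in its usual form; for `n = 1` the sum is empty. -/
theorem dS_recursion (s₀ : ℂ → ℂ) (n : ℕ) (hn : 1 ≤ n) (z : ℂ) :
    dS s₀ n z = -(1 / (2 * s₀ z)) *
      ((∑ j ∈ Finset.Ico 1 n, dS s₀ j z * dS s₀ (n - j) z) + deriv (dS s₀ (n - 1)) z) := by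
  obtain ⟨m, rfl⟩ : ∃ m, n = m + 1 := ⟨n - 1, by omega⟩
  rw [dS, Finset.sum_Ico_eq_sum_range, Finset.sum_range]
  simp only [Nat.add_sub_cancel]
  congr 2
  refine Finset.sum_congr rfl fun j _ => ?_
  rw [Nat.add_comm 1 (j : ℕ), Nat.add_sub_add_right]

/-- `S_n(x) = ∫_ξ^x S_n'(τ) dτ`. -/
def S (s₀ : ℂ → ℂ) (ξ : ℝ) (n : ℕ) (x : ℝ) : ℂ :=
  ∫ τ in ξ..x, dS s₀ n (τ : ℂ)

/-- `∑_{n=0}^N εⁿ S_n'(x)`. -/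
def dSum (s₀ : ℂ → ℂ) (N : ℕ) (ε x : ℝ) : ℂ :=
  ∑ n ∈ Finset.range (N + 1), (ε : ℂ) ^ n * dS s₀ n (x : ℂ)

/-- `exp(∑_{n=0}^N ε^(n-1) S_n(x))`. -/
def expSum (s₀ : ℂ → ℂ) (ξ : ℝ) (N : ℕ) (ε x : ℝ) : ℂ :=
  Complex.exp (∑ n ∈ Finset.range (N + 1), (ε : ℂ) ^ ((n : ℤ) - 1) * S s₀ ξ n x)

/-- `(S_0^+)' = i √a`, where `σ` is the analytic extension of `√a`. -/
def sPlus (σ : ℂ → ℂ) : ℂ → ℂ := fun z => Complex.I * σ z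

/-- `(S_0^-)' = - i √a`, where `σ` is the analytic extension of `√a`. -/
def sMinus (σ : ℂ → ℂ) : ℂ → ℂ := fun z => -Complex.I * σ z

/-- The common denominator of the two coefficients,
`∑_{n=0}^N εⁿ ((S_n^+)'(ξ) - (S_n^-)'(ξ))`. -/
def denom (σ : ℂ → ℂ) (ξ : ℝ) (N : ℕ) (ε : ℝ) : ℂ :=
  ∑ n ∈ Finset.range (N + 1),
    (ε : ℂ) ^ n * (dS (sPlus σ) n (ξ : ℂ) - dS (sMinus σ) n (ξ : ℂ))

/-- The coefficient `α_{N,ε}`. -/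
def alpha (σ : ℂ → ℂ) (ξ : ℝ) (N : ℕ) (ε : ℝ) (φ₀ φ₁ : ℂ) : ℂ :=
  (φ₀ * dSum (sPlus σ) N ε ξ - φ₁) / denom σ ξ N ε

/-- The coefficient `β_{N,ε}`. -/
def beta (σ : ℂ → ℂ) (ξ : ℝ) (N : ℕ) (ε : ℝ) (φ₀ φ₁ : ℂ) : ℂ :=
  (φ₁ - φ₀ * dSum (sMinus σ) N ε ξ) / denom σ ξ N ε

/-- The truncated WKB approximation `φ_N^WKB`. -/
def approx (σ : ℂ → ℂ) (ξ : ℝ) (N : ℕ) (ε : ℝ) (φ₀ φ₁ : ℂ) (x : ℝ) : ℂ :=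
  alpha σ ξ N ε φ₀ φ₁ * expSum (sMinus σ) ξ N ε x +
    beta σ ξ N ε φ₀ φ₁ * expSum (sPlus σ) ξ N ε x

/-- `φ` is a (classical) solution on `[ξ, η]` of
`ε² φ'' + a φ = 0`, `φ(ξ) = φ₀`, `ε φ'(ξ) = φ₁`. -/
def IsSolution (a : ℝ → ℝ) (ξ η ε : ℝ) (φ₀ φ₁ : ℂ) (φ : ℝ → ℂ) : Prop :=
  ∃ dφ ddφ : ℝ → ℂ,
    (∀ x ∈ Set.Icc ξ η, HasDerivWithinAt φ (dφ x) (Set.Icc ξ η) x) ∧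
    (∀ x ∈ Set.Icc ξ η, HasDerivWithinAt dφ (ddφ x) (Set.Icc ξ η) x) ∧
    (∀ x ∈ Set.Icc ξ η, (ε : ℂ) ^ 2 * ddφ x + (a x : ℂ) * φ x = 0) ∧
    φ ξ = φ₀ ∧ (ε : ℂ) * dφ ξ = φ₁

/-- The estimates on `S_n` and on `S_n^{(k)}`, `k ≥ 1`, over `I = [ξ, η]`, with constants
`K₁, K₂` and `M = ‖S_0'‖_{L^∞(G)}`, for the sequence started at `s₀`. Here `0 ^ 0 = 1`. -/
def Estimates (s₀ : ℂ → ℂ) (ξ η M K₁ K₂ : ℝ) : Prop :=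
  (∀ n : ℕ, LInf (Set.Icc ξ η) (S s₀ ξ n) ≤
    ENNReal.ofReal ((η - ξ) * M * K₂ ^ n * (n : ℝ) ^ n)) ∧
  (∀ n k : ℕ, 1 ≤ k →
    LInf (Set.Icc ξ η) (fun x : ℝ => iteratedDeriv (k - 1) (dS s₀ n) (x : ℂ)) ≤
      ENNReal.ofReal
        (M * ((k - 1).factorial : ℝ) * K₁ ^ (k - 1) * K₂ ^ n * (n : ℝ) ^ n))

/-- `K₁, K₂` are positive constants for which the estimates hold for both sequences
`(S_n^-)` and `(S_n^+)`. -/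
def AdmissibleConstants (σ : ℂ → ℂ) (ξ η M K₁ K₂ : ℝ) : Prop :=
  0 < K₁ ∧ 0 < K₂ ∧
    Estimates (sMinus σ) ξ η M K₁ K₂ ∧ Estimates (sPlus σ) ξ η M K₁ K₂

/-- The right-hand side of the error estimate; `L = η - ξ`, `M = ‖S_0'‖_{L^∞(G)}`,
`p = |φ₀|`, `q = |φ₁|`. -/
def errorBound (C L M K₂ : ℝ) (N : ℕ) (ε p q : ℝ) : ℝ :=
  C * M ^ 2 *
    (p * M * (∑ n ∈ Finset.range (N + 1), ε ^ n * K₂ ^ n * (n : ℝ) ^ n) + q) *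
    Real.exp (L * M * ∑ n ∈ Finset.range (N / 2 + 1),
      ε ^ (2 * n) * K₂ ^ (2 * n + 1) * ((2 * n + 1 : ℕ) : ℝ) ^ (2 * n + 1)) *
    (2 * ε ^ N * K₂ ^ (N + 1) * ((N + 1 : ℕ) : ℝ) ^ (N + 1) +
      ∑ n ∈ Finset.Icc 2 N, ε ^ (N + n - 1) * K₂ ^ (N + n) *
        ∑ k ∈ Finset.Icc 2 (N + n),
          (k : ℝ) ^ k * ((N + n - k : ℕ) : ℝ) ^ (N + n - k))

end

end WKB

/-!
On discs about the points of `I`, Cauchy's estimates in Nagumo norms give `|S_n'| ≤ M Kⁿ nⁿ`; the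
quadratic term of the recursion preserves this shape because `∑_{0<j<n} j^j (n-j)^(n-j) ≤ n^n`.

The function `exp(∑ ε^(n-1) S_n)` solves the differential equation up to the residual of
`u = ∑ εⁿ S_n'` in the Riccati equation `u² + ε u' = S_0'²`, and the recursion cancels all powers
of `ε` up to `ε^N` in that residual. On `I` the phases `S_0^±` are purely imaginary, so both
exponentials are bounded uniformly in `ε`, and for `ε ≤ c / (N + 1)` also uniformly in `N`, the
remaining exponent being dominated by a geometric series. Hence `φ_N^WKB` has a residual of order
`ε^(N+1)`. The error `e = φ - φ_N^WKB` has zero initial data, and a Gronwall inequality for its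
energy `ε² |e'|² + a |e|²` bounds `|e|` by the residual divided by `ε`.
-/

namespace WKB

theorem self_le_choose {n j : ℕ} (hj : 1 ≤ j) (hjn : j < n) : n ≤ n.choose j := by
  induction n generalizing j with
  | zero => omega
  | succ n ih =>
    obtain ⟨i, rfl⟩ := Nat.exists_eq_add_of_le' hj
    rw [Nat.choose_succ_succ']
    have hi : 0 < n.choose i := Nat.choose_pos (by omega)
    rcases Nat.lt_or_ge (i + 1) n with hin | hni
    · have := ih (Nat.le_add_left 1 i) hin
      omega
    · obtain rfl : n = i + 1 := by omega
      simp

theorem pow_self_mul_pow_self_le {n j : ℕ} (hj : 1 ≤ j) (hjn : j < n) :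
    j ^ j * (n - j) ^ (n - j) ≤ n ^ (n - 1) := by
  have hbinom : n.choose j * (j ^ j * (n - j) ^ (n - j)) ≤ n ^ n := by
    have h := add_pow j (n - j) n
    rw [Nat.add_sub_cancel' hjn.le] at h
    rw [h, mul_comm]
    exact Finset.single_le_sum_of_canonicallyOrdered
      (f := fun i => j ^ i * (n - j) ^ (n - i) * n.choose i) (Finset.mem_range.2 (by omega))
  refine Nat.le_of_mul_le_mul_left ?_ (by omega : 0 < n)
  calc n * (j ^ j * (n - j) ^ (n - j)) ≤ n.choose j * (j ^ j * (n - j) ^ (n - j)) :=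
        Nat.mul_le_mul_right _ (self_le_choose hj hjn)
    _ ≤ n ^ n := hbinom
    _ = n * n ^ (n - 1) := by rw [← pow_succ', Nat.sub_add_cancel (by omega)]

theorem sum_pow_self_mul_pow_self_le {n : ℕ} (hn : 1 ≤ n) :
    ∑ j ∈ Finset.Ico 1 n, j ^ j * (n - j) ^ (n - j) ≤ n ^ n :=
  calc ∑ j ∈ Finset.Ico 1 n, j ^ j * (n - j) ^ (n - j)
      ≤ ∑ _ ∈ Finset.Ico 1 n, n ^ (n - 1) := Finset.sum_le_sum fun j hj =>
        pow_self_mul_pow_self_le (Finset.mem_Ico.1 hj).1 (Finset.mem_Ico.1 hj).2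
    _ = (n - 1) * n ^ (n - 1) := by simp
    _ ≤ n * n ^ (n - 1) := Nat.mul_le_mul_right _ (by omega)
    _ = n ^ n := by rw [← pow_succ', Nat.sub_add_cancel hn]

theorem analyticAt_dS {s₀ : ℂ → ℂ} {z : ℂ} (hs : AnalyticAt ℂ s₀ z) (h0 : s₀ z ≠ 0) (n : ℕ) :
    AnalyticAt ℂ (dS s₀ n) z := by
  induction n using Nat.strong_induction_on with
  | _ n ih =>
    rcases Nat.eq_zero_or_pos n with rfl | hn
    · rwa [dS_zero]
    · rw [funext (dS_recursion s₀ n hn)]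
      refine AnalyticAt.fun_mul
        (analyticAt_const.fun_div (analyticAt_const.fun_mul hs) (by simpa using h0)).fun_neg
        (AnalyticAt.fun_add (Finset.analyticAt_fun_sum _ fun j hj => ?_)
          (ih (n - 1) (by omega)).deriv)
      rw [Finset.mem_Ico] at hj
      exact (ih j hj.2).fun_mul (ih (n - j) (by omega))

/-- `NagumoBound c δ n B f` says that the Nagumo norm of order `n` of `f` on the disc of radius `δ`
about `c`, i.e. the supremum of `dist(z, ∂)ⁿ |f z|`, is at most `B`. Such norms turn iterated Cauchy
estimates into an induction on `n`. The boundary distance enters through all its lower bounds `t`,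
and `t = 0` is allowed so that the order `n = 0` is not exceptional (`0 ^ 0 = 1`). -/
def NagumoBound (c : ℂ) (δ : ℝ) (n : ℕ) (B : ℝ) (f : ℂ → ℂ) : Prop :=
  ∀ t, 0 ≤ t → ∀ z ∈ Metric.ball c (δ - t), t ^ n * ‖f z‖ ≤ B

namespace NagumoBound

variable {c : ℂ} {δ B B' : ℝ} {n n' : ℕ} {f g : ℂ → ℂ}

theorem mono (hf : NagumoBound c δ n B f) (hB : B ≤ B') : NagumoBound c δ n B' f :=
  fun t ht z hz => (hf t ht z hz).trans hB

theorem of_forall_norm_le (hf : ∀ z ∈ Metric.ball c δ, ‖f z‖ ≤ B) : NagumoBound c δ 0 B f :=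
  fun t ht z hz => by simpa using hf z (Metric.ball_subset_ball (by linarith) hz)

theorem add (hf : NagumoBound c δ n B f) (hg : NagumoBound c δ n B' g) :
    NagumoBound c δ n (B + B') fun z => f z + g z := fun t ht z hz =>
  calc t ^ n * ‖f z + g z‖ ≤ t ^ n * ‖f z‖ + t ^ n * ‖g z‖ := by
        rw [← mul_add]
        gcongr
        exact norm_add_le _ _
    _ ≤ B + B' := add_le_add (hf t ht z hz) (hg t ht z hz)

theorem sum {ι : Type*} {I : Finset ι} {b : ι → ℝ} {F : ι → ℂ → ℂ}
    (hF : ∀ i ∈ I, NagumoBound c δ n (b i) (F i)) :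
    NagumoBound c δ n (∑ i ∈ I, b i) fun z => ∑ i ∈ I, F i z := fun t ht z hz =>
  calc t ^ n * ‖∑ i ∈ I, F i z‖ ≤ ∑ i ∈ I, t ^ n * ‖F i z‖ := by
        rw [← Finset.mul_sum]
        gcongr
        exact norm_sum_le _ _
    _ ≤ ∑ i ∈ I, b i := Finset.sum_le_sum fun i hi => hF i hi t ht z hz

theorem mul (hf : NagumoBound c δ n B f) (hg : NagumoBound c δ n' B' g) :
    NagumoBound c δ (n + n') (B * B') fun z => f z * g z := fun t ht z hz => by
  have hft := hf t ht z hz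
  calc t ^ (n + n') * ‖f z * g z‖ = (t ^ n * ‖f z‖) * (t ^ n' * ‖g z‖) := by
        rw [norm_mul, pow_add]
        ring
    _ ≤ B * B' := mul_le_mul hft (hg t ht z hz) (by positivity) (le_trans (by positivity) hft)

theorem sum_Ico_mul_self {F : ℕ → ℂ → ℂ} {A K : ℝ} (hK : 0 ≤ K) (hn : 1 ≤ n)
    (hF : ∀ j ∈ Finset.Ico 1 n, NagumoBound c δ j (A * K ^ j * (j : ℝ) ^ j) (F j)) :
    NagumoBound c δ n (A ^ 2 * K ^ n * (n : ℝ) ^ n)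
      fun z => ∑ j ∈ Finset.Ico 1 n, F j z * F (n - j) z := by
  have hterm : ∀ j ∈ Finset.Ico 1 n, NagumoBound c δ n
      (A ^ 2 * K ^ n * ((j ^ j * (n - j) ^ (n - j) : ℕ) : ℝ)) fun z => F j z * F (n - j) z := by
    intro j hj
    obtain ⟨hj1, hjn⟩ := Finset.mem_Ico.1 hj
    have h := (hF j hj).mul (hF (n - j) (Finset.mem_Ico.2 ⟨by omega, by omega⟩))
    rw [Nat.add_sub_cancel' hjn.le] at h
    refine h.mono (le_of_eq ?_)
    rw [← pow_mul_pow_sub K hjn.le]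
    push_cast
    ring
  refine (NagumoBound.sum hterm).mono ?_
  rw [← Finset.mul_sum]
  gcongr
  exact_mod_cast sum_pow_self_mul_pow_self_le hn

/-- The Cauchy estimate on the circle of radius `t / (n + 1)`, the choice that optimizes the
loss in the constant. -/
theorem deriv {C : ℝ} (hd : DifferentiableOn ℂ f (Metric.ball c δ))
    (hf : NagumoBound c δ n (C * (n : ℝ) ^ n) f) :
    NagumoBound c δ (n + 1) (C * ((n + 1 : ℕ) : ℝ) ^ (n + 1)) (deriv f) := by
  intro t ht z hz
  have hnn : (0 : ℝ) < (n : ℝ) ^ n := by exact_mod_cast Nat.pow_self_pos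
  have hC : 0 ≤ C := nonneg_of_mul_nonneg_left
    ((by positivity : 0 ≤ t ^ n * ‖f z‖).trans (hf t ht z hz)) hnn
  rcases ht.eq_or_lt with rfl | ht
  · rw [zero_pow n.succ_ne_zero, zero_mul]
    positivity
  set R := t / ((n + 1 : ℕ) : ℝ) with hR
  have hR0 : 0 < R := by positivity
  have htR : t = R * (n + 1) := by rw [hR]; push_cast; field_simp
  have hsub : Metric.closedBall z R ⊆ Metric.ball c (δ - R * n) :=
    Metric.closedBall_subset_ball' (by linarith [Metric.mem_ball.1 hz])
  have hcircle : ∀ w ∈ Metric.sphere z R, ‖f w‖ ≤ C / R ^ n := by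
    intro w hw
    have h := hf (R * n) (by positivity) w (hsub (Metric.sphere_subset_closedBall hw))
    rw [le_div_iff₀ (by positivity)]
    refine le_of_mul_le_mul_right ?_ hnn
    calc ‖f w‖ * R ^ n * (n : ℝ) ^ n = (R * n) ^ n * ‖f w‖ := by rw [mul_pow]; ring
      _ ≤ C * (n : ℝ) ^ n := h
  have hball : Metric.closedBall z R ⊆ Metric.ball c δ :=
    hsub.trans (Metric.ball_subset_ball (sub_le_self δ (by positivity)))
  calc t ^ (n + 1) * ‖_root_.deriv f z‖ ≤ t ^ (n + 1) * (C / R ^ n / R) := by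
        gcongr
        exact Complex.norm_deriv_le_of_forall_mem_sphere_norm_le hR0
          (hd.diffContOnCl_ball hball) hcircle
    _ = C * ((n + 1 : ℕ) : ℝ) ^ (n + 1) := by
        rw [div_div, ← pow_succ, hR, div_pow]
        field_simp

end NagumoBound

section CauchyEstimates

variable {s₀ : ℂ → ℂ} {c : ℂ} {δ m M : ℝ}

/-- The rate `M / m ^ 2` makes the quadratic term and the derivative term of the recursion each
contribute half of the bound. -/
theorem nagumoBound_dS (hm : 0 < m) (hmM : m ≤ M) (hs : AnalyticOnNhd ℂ s₀ (Metric.ball c δ))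
    (hlow : ∀ z ∈ Metric.ball c δ, m ≤ ‖s₀ z‖) (hup : ∀ z ∈ Metric.ball c δ, ‖s₀ z‖ ≤ M)
    {n : ℕ} (hn : 1 ≤ n) :
    NagumoBound c δ n (m * (M / m ^ 2) ^ n * (n : ℝ) ^ n) (dS s₀ n) := by
  have hM : 0 < M := hm.trans_le hmM
  induction n using Nat.strong_induction_on with
  | _ n ih =>
    obtain ⟨k, rfl⟩ := Nat.exists_eq_add_of_le' hn
    have hinv : NagumoBound c δ 0 (1 / (2 * m)) fun z => -(1 / (2 * s₀ z)) :=
      NagumoBound.of_forall_norm_le fun z hz => by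
        rw [norm_neg, norm_div, norm_one, norm_mul, Complex.norm_ofNat]
        gcongr
        exact hlow z hz
    have hderiv : NagumoBound c δ (k + 1) (M * (M / m ^ 2) ^ k * ((k + 1 : ℕ) : ℝ) ^ (k + 1))
        (deriv (dS s₀ k)) := by
      refine NagumoBound.deriv (fun z hz => (analyticAt_dS (hs z hz)
        (norm_pos_iff.1 (hm.trans_le (hlow z hz))) k).differentiableAt.differentiableWithinAt) ?_
      rcases Nat.eq_zero_or_pos k with rfl | hk
      · simpa [dS_zero] using NagumoBound.of_forall_norm_le hup
      · exact (ih k k.lt_succ_self hk).mono (by gcongr)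
    have hsum := NagumoBound.sum_Ico_mul_self (by positivity) hn fun j hj =>
      ih j (Finset.mem_Ico.1 hj).2 (Finset.mem_Ico.1 hj).1
    have h := hinv.mul (hsum.add hderiv)
    rw [zero_add] at h
    rw [funext (dS_recursion s₀ (k + 1) hn)]
    have hMK : m ^ 2 * (M / m ^ 2) = M := by field_simp
    refine h.mono (le_of_eq ?_)
    generalize M / m ^ 2 = K at hMK ⊢
    rw [← hMK, pow_succ K]
    field_simp
    ring

theorem norm_dS_le_of_mem_ball (hm : 0 < m) (hδ : 0 < δ)
    (hs : AnalyticOnNhd ℂ s₀ (Metric.ball c δ)) (hlow : ∀ z ∈ Metric.ball c δ, m ≤ ‖s₀ z‖)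
    (hup : ∀ z ∈ Metric.ball c δ, ‖s₀ z‖ ≤ M) (n : ℕ) {z : ℂ}
    (hz : z ∈ Metric.ball c (δ / 2)) :
    ‖dS s₀ n z‖ ≤ M * (2 * M / (m ^ 2 * δ)) ^ n * (n : ℝ) ^ n := by
  have hc := Metric.mem_ball_self (x := c) hδ
  have hmM : m ≤ M := (hlow c hc).trans (hup c hc)
  have hM : 0 < M := hm.trans_le hmM
  rcases Nat.eq_zero_or_pos n with rfl | hn
  · simpa [dS_zero] using hup z (Metric.ball_subset_ball (by linarith) hz)
  · have h := nagumoBound_dS hm hmM hs hlow hup hn (δ / 2) (by positivity) z (by rwa [sub_half])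
    rw [mul_comm, ← le_div_iff₀ (by positivity)] at h
    calc ‖dS s₀ n z‖ ≤ m * (M / m ^ 2) ^ n * (n : ℝ) ^ n / (δ / 2) ^ n := h
      _ = m * (2 * M / (m ^ 2 * δ)) ^ n * (n : ℝ) ^ n := by
          simp only [div_pow, mul_pow]
          field_simp
      _ ≤ M * (2 * M / (m ^ 2 * δ)) ^ n * (n : ℝ) ^ n := by gcongr

end CauchyEstimates

section LInf

variable {X : Type*} [MeasureSpace X] {s : Set X} {f : X → ℂ} {B : ℝ}

theorem LInf_le_of_forall_norm_le (hs : MeasurableSet s) (h : ∀ x ∈ s, ‖f x‖ ≤ B) :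
    LInf s f ≤ ENNReal.ofReal B := by
  rw [LInf, eLpNorm_exponent_top]
  exact eLpNormEssSup_le_of_ae_bound ((ae_restrict_iff' hs).2 (Filter.Eventually.of_forall h))

variable [TopologicalSpace X] [(volume : Measure X).IsOpenPosMeasure]

theorem enorm_le_LInf (hs : s ⊆ closure (interior s)) (hf : ContinuousOn f s) {x : X}
    (hx : x ∈ s) : ‖f x‖ₑ ≤ LInf s f := by
  have hmax : (fun x => max ‖f x‖ₑ (LInf s f)) =ᵐ[volume.restrict s] fun _ => LInf s f := by
    filter_upwards [enorm_ae_le_eLpNormEssSup f (volume.restrict s)] with y hy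
    exact max_eq_right (by rwa [LInf, eLpNorm_exponent_top])
  exact max_eq_right_iff.1 (Measure.eqOn_of_ae_eq hmax (hf.enorm.sup continuousOn_const)
    continuousOn_const hs hx)

theorem norm_le_of_LInf_le (hs : s ⊆ closure (interior s)) (hf : ContinuousOn f s) (hB : 0 ≤ B)
    (h : LInf s f ≤ ENNReal.ofReal B) {x : X} (hx : x ∈ s) : ‖f x‖ ≤ B := by
  have hle := (enorm_le_LInf hs hf hx).trans h
  rwa [← ofReal_norm, ENNReal.ofReal_le_ofReal_iff hB] at hle

theorem norm_le_toReal_LInf [OpensMeasurableSpace X] (hs : IsOpen s) (hf : ContinuousOn f s)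
    (hb : Bornology.IsBounded (f '' s)) {x : X} (hx : x ∈ s) : ‖f x‖ ≤ (LInf s f).toReal := by
  obtain ⟨B, hB⟩ := hb.exists_norm_le
  have hfin : LInf s f ≠ ∞ := ne_top_of_le_ne_top ENNReal.ofReal_ne_top
    (LInf_le_of_forall_norm_le hs.measurableSet fun y hy => hB _ (Set.mem_image_of_mem f hy))
  exact norm_le_of_LInf_le (hs.interior_eq.symm ▸ subset_closure) hf ENNReal.toReal_nonneg
    (ENNReal.ofReal_toReal hfin).ge hx

end LInf

section Existence

variable {s₀ : ℂ → ℂ} {ξ η M K ρ : ℝ}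

theorem norm_S_le {B : ℝ} {n : ℕ} (hb : ∀ x ∈ Set.Icc ξ η, ‖dS s₀ n x‖ ≤ B) {x : ℝ}
    (hx : x ∈ Set.Icc ξ η) : ‖S s₀ ξ n x‖ ≤ (η - ξ) * B := by
  have hB : 0 ≤ B := (norm_nonneg _).trans (hb x hx)
  calc ‖S s₀ ξ n x‖ ≤ B * |x - ξ| :=
        intervalIntegral.norm_integral_le_of_norm_le_const fun τ hτ => by
          rw [Set.uIoc_of_le hx.1] at hτ
          exact hb τ ⟨hτ.1.le, hτ.2.trans hx.2⟩
    _ ≤ B * (η - ξ) := by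
        rw [abs_of_nonneg (sub_nonneg.2 hx.1)]
        gcongr
        exact hx.2
    _ = (η - ξ) * B := mul_comm _ _

theorem estimates_of_norm_dS_le (hρ : 0 < ρ)
    (hs : ∀ x ∈ Set.Icc ξ η, ∀ n, DifferentiableOn ℂ (dS s₀ n) (Metric.ball (x : ℂ) ρ))
    (hb : ∀ x ∈ Set.Icc ξ η, ∀ n, ∀ z ∈ Metric.ball (x : ℂ) ρ,
      ‖dS s₀ n z‖ ≤ M * K ^ n * (n : ℝ) ^ n) :
    Estimates s₀ ξ η M (2 / ρ) K := by
  refine ⟨fun n => LInf_le_of_forall_norm_le measurableSet_Icc fun x hx => ?_,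
    fun n k _ => LInf_le_of_forall_norm_le measurableSet_Icc fun x hx => ?_⟩
  · refine (norm_S_le (fun y hy => hb y hy n y (Metric.mem_ball_self hρ)) hx).trans_eq ?_
    ring
  · have hball : Metric.closedBall (x : ℂ) (ρ / 2) ⊆ Metric.ball (x : ℂ) ρ :=
      Metric.closedBall_subset_ball (half_lt_self hρ)
    refine (Complex.norm_iteratedDeriv_le_of_forall_mem_sphere_norm_le (k - 1) (half_pos hρ)
      ((hs x hx n).diffContOnCl_ball hball)
      fun w hw => hb x hx n w (hball (Metric.sphere_subset_closedBall hw))).trans_eq ?_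
    rw [div_pow ρ, div_pow 2]
    field_simp

theorem exists_ball_subset_inter_lt_norm {m : ℝ} {G : Set ℂ} (hG : IsOpen G)
    (hIG : ∀ x ∈ Set.Icc ξ η, (x : ℂ) ∈ G) {f : ℂ → ℂ} (hf : ContinuousOn f G)
    (hfm : ∀ x ∈ Set.Icc ξ η, m < ‖f x‖) :
    ∃ δ > 0, ∀ x ∈ Set.Icc ξ η, ∀ z ∈ Metric.ball (x : ℂ) δ, z ∈ G ∧ m < ‖f z‖ := by
  have hopen : IsOpen (G ∩ (fun z => ‖f z‖) ⁻¹' Set.Ioi m) :=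
    hf.norm.isOpen_inter_preimage hG isOpen_Ioi
  obtain ⟨δ, hδ, hsub⟩ :=
    (isCompact_Icc.image Complex.continuous_ofReal).exists_thickening_subset_open hopen
      (Set.image_subset_iff.2 fun x hx => ⟨hIG x hx, hfm x hx⟩)
  exact ⟨δ, hδ, fun x hx z hz => hsub
    (Metric.ball_subset_thickening (Set.mem_image_of_mem Complex.ofReal hx) δ hz)⟩

theorem exists_admissibleConstants {m : ℝ} (hξη : ξ < η) (hm : 0 < m) {G : Set ℂ}
    (hG : IsOpen G) (hIG : ∀ x ∈ Set.Icc ξ η, (x : ℂ) ∈ G) {σ : ℂ → ℂ}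
    (hσ : AnalyticOnNhd ℂ σ G) (hσm : ∀ x ∈ Set.Icc ξ η, m ≤ ‖σ x‖)
    (hσM : ∀ z ∈ G, ‖σ z‖ ≤ M) : ∃ K₁ K₂ : ℝ, AdmissibleConstants σ ξ η M K₁ K₂ := by
  have hξ : ξ ∈ Set.Icc ξ η := Set.left_mem_Icc.2 hξη.le
  have hM : 0 < M := hm.trans_le ((hσm ξ hξ).trans (hσM _ (hIG ξ hξ)))
  obtain ⟨δ, hδ, hball⟩ := exists_ball_subset_inter_lt_norm hG hIG hσ.continuousOn
    fun x hx => (half_lt_self hm).trans_le (hσm x hx)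
  have hest : ∀ c : ℂ, ‖c‖ = 1 → Estimates (fun z => c * σ z) ξ η M (2 / (δ / 2))
      (2 * M / ((m / 2) ^ 2 * δ)) := by
    intro c hc
    have hnorm : ∀ z, ‖c * σ z‖ = ‖σ z‖ := fun z => by rw [norm_mul, hc, one_mul]
    have hlow : ∀ x ∈ Set.Icc ξ η, ∀ z ∈ Metric.ball (x : ℂ) δ, m / 2 ≤ ‖c * σ z‖ :=
      fun x hx z hz => (hnorm z).symm ▸ (hball x hx z hz).2.le
    have hs : ∀ x ∈ Set.Icc ξ η,
        AnalyticOnNhd ℂ (fun z => c * σ z) (Metric.ball (x : ℂ) δ) :=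
      fun x hx z hz => analyticAt_const.fun_mul (hσ z (hball x hx z hz).1)
    refine estimates_of_norm_dS_le (half_pos hδ) (fun x hx n z hz => ?_) fun x hx n z hz =>
      norm_dS_le_of_mem_ball (half_pos hm) hδ (hs x hx) (hlow x hx)
        (fun w hw => (hnorm w).symm ▸ hσM w (hball x hx w hw).1) n hz
    have hz := Metric.ball_subset_ball (half_le_self hδ.le) hz
    exact (analyticAt_dS (hs x hx z hz) (norm_pos_iff.1 ((half_pos hm).trans_le (hlow x hx z hz)))
      n).differentiableAt.differentiableWithinAt
  exact ⟨_, _, by positivity, by positivity, hest (-Complex.I) (by simp), hest Complex.I (by simp)⟩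

end Existence

section Derivatives

variable {s₀ : ℂ → ℂ} {ξ η x : ℝ}

theorem hasDerivAt_dS (hs : AnalyticAt ℂ s₀ x) (h0 : s₀ x ≠ 0) (n : ℕ) :
    HasDerivAt (fun y : ℝ => dS s₀ n y) (deriv (dS s₀ n) x) x :=
  (analyticAt_dS hs h0 n).differentiableAt.hasDerivAt.comp_ofReal

theorem hasDerivAt_dSum (hs : AnalyticAt ℂ s₀ x) (h0 : s₀ x ≠ 0) (N : ℕ) (ε : ℝ) :
    HasDerivAt (dSum s₀ N ε)
      (∑ n ∈ Finset.range (N + 1), (ε : ℂ) ^ n * deriv (dS s₀ n) x) x :=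
  HasDerivAt.fun_sum fun n _ => (hasDerivAt_dS hs h0 n).const_mul _

theorem hasDerivAt_S (hs : ∀ y ∈ Set.Icc ξ η, AnalyticAt ℂ s₀ y)
    (h0 : ∀ y ∈ Set.Icc ξ η, s₀ y ≠ 0) (n : ℕ) (hx : x ∈ Set.Icc ξ η) :
    HasDerivAt (S s₀ ξ n) (dS s₀ n x) x := by
  have hcont : ∀ y ∈ Set.Icc ξ η, ContinuousAt (fun y : ℝ => dS s₀ n y) y := fun y hy =>
    (hasDerivAt_dS (hs y hy) (h0 y hy) n).continuousAt
  refine intervalIntegral.integral_hasDerivAt_right (ContinuousOn.intervalIntegrable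
    fun y hy => ?_) ?_ (hcont x hx)
  · rw [Set.uIcc_of_le hx.1] at hy
    exact (hcont y ⟨hy.1, hy.2.trans hx.2⟩).continuousWithinAt
  · exact ContinuousAt.stronglyMeasurableAtFilter
      ((isOpen_analyticAt ℂ (dS s₀ n)).preimage Complex.continuous_ofReal)
      (fun y hy => (AnalyticAt.continuousAt hy).comp Complex.continuous_ofReal.continuousAt) x
      (analyticAt_dS (hs x hx) (h0 x hx) n)

theorem hasDerivAt_expSum (hs : ∀ y ∈ Set.Icc ξ η, AnalyticAt ℂ s₀ y)
    (h0 : ∀ y ∈ Set.Icc ξ η, s₀ y ≠ 0) (N : ℕ) {ε : ℝ} (hε : ε ≠ 0) (hx : x ∈ Set.Icc ξ η) :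
    HasDerivAt (expSum s₀ ξ N ε) ((ε : ℂ)⁻¹ * dSum s₀ N ε x * expSum s₀ ξ N ε x) x := by
  refine (HasDerivAt.fun_sum fun n (_ : n ∈ Finset.range (N + 1)) =>
    (hasDerivAt_S hs h0 n hx).const_mul ((ε : ℂ) ^ ((n : ℤ) - 1))).cexp.congr_deriv ?_
  rw [mul_comm, expSum, dSum, Finset.mul_sum]
  congr 1
  refine Finset.sum_congr rfl fun n _ => ?_
  rw [zpow_sub_one₀ (Complex.ofReal_ne_zero.2 hε), zpow_natCast]
  ring

theorem norm_dS_le_of_estimates {M K₁ K₂ : ℝ} (hξη : ξ < η) (hM : 0 ≤ M) (hK₂ : 0 ≤ K₂)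
    (hs : ∀ y ∈ Set.Icc ξ η, AnalyticAt ℂ s₀ y) (h0 : ∀ y ∈ Set.Icc ξ η, s₀ y ≠ 0)
    (hE : Estimates s₀ ξ η M K₁ K₂) (n : ℕ) (hx : x ∈ Set.Icc ξ η) :
    ‖dS s₀ n x‖ ≤ M * K₂ ^ n * (n : ℝ) ^ n := by
  have h := hE.2 n 1 le_rfl
  simp only [Nat.sub_self, iteratedDeriv_zero, Nat.factorial_zero, Nat.cast_one, pow_zero,
    mul_one] at h
  have hcont : ContinuousOn (fun y : ℝ => dS s₀ n y) (Set.Icc ξ η) := fun y hy =>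
    (hasDerivAt_dS (hs y hy) (h0 y hy) n).continuousAt.continuousWithinAt
  exact norm_le_of_LInf_le (by rw [interior_Icc, closure_Ioo hξη.ne]) hcont (by positivity) h hx

end Derivatives

section Residual

open Finset.HasAntidiagonal (antidiagonal mem_antidiagonal)

theorem sum_range_product_eq_sum_antidiagonal {R : Type*} [AddCommMonoid R] (N : ℕ)
    (F : ℕ × ℕ → R) :
    ∑ p ∈ Finset.range (N + 1) ×ˢ Finset.range (N + 1), F p + (F (0, N + 1) + F (N + 1, 0)) =
      ∑ m ∈ Finset.range (N + 2), ∑ p ∈ antidiagonal m, F p +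
        ∑ n ∈ Finset.Icc 2 N, ∑ k ∈ Finset.Icc n N, F (k, N + n - k) := by
  have hlow : ∑ m ∈ Finset.range (N + 2), ∑ p ∈ antidiagonal m, F p =
      ∑ p ∈ Finset.range (N + 2) ×ˢ Finset.range (N + 2) with p.1 + p.2 ≤ N + 1, F p := by
    rw [Finset.sum_sigma']
    refine Finset.sum_nbij' (fun q => q.2) (fun p => ⟨p.1 + p.2, p⟩) ?_ ?_ ?_ ?_ ?_ <;>
      simp only [Finset.mem_sigma, Finset.mem_filter, Finset.mem_product, Finset.mem_range,
        mem_antidiagonal, Sigma.forall, Prod.forall] <;> grind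
  have hhigh : ∑ n ∈ Finset.Icc 2 N, ∑ k ∈ Finset.Icc n N, F (k, N + n - k) =
      ∑ p ∈ Finset.range (N + 1) ×ˢ Finset.range (N + 1) with ¬ p.1 + p.2 ≤ N + 1, F p := by
    rw [Finset.sum_sigma']
    refine Finset.sum_nbij' (fun q => (q.2, N + q.1 - q.2)) (fun p => ⟨p.1 + p.2 - N, p.1⟩)
      ?_ ?_ ?_ ?_ ?_ <;>
      simp only [Finset.mem_sigma, Finset.mem_filter, Finset.mem_product, Finset.mem_range,
        Finset.mem_Icc, Sigma.forall, Prod.forall] <;> grind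
  have hcorner : ({p ∈ Finset.range (N + 2) ×ˢ Finset.range (N + 2) | p.1 + p.2 ≤ N + 1} :
      Finset (ℕ × ℕ)) = insert (0, N + 1) (insert (N + 1, 0)
        {p ∈ Finset.range (N + 1) ×ˢ Finset.range (N + 1) | p.1 + p.2 ≤ N + 1}) := by
    ext ⟨i, j⟩
    simp only [Finset.mem_filter, Finset.mem_product, Finset.mem_range, Finset.mem_insert,
      Prod.mk.injEq]
    omega
  rw [hlow, hhigh, hcorner, Finset.sum_insert (by simp), Finset.sum_insert (by simp),
    ← Finset.sum_filter_add_sum_filter_not (Finset.range (N + 1) ×ˢ Finset.range (N + 1))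
      (fun p => p.1 + p.2 ≤ N + 1)]
  abel

variable {s₀ : ℂ → ℂ}

/-- The recursion solved for the derivative: the coefficients of `εⁿ⁺¹` in the Riccati equation
`u² + ε u' = s₀²` for `u = ∑ εⁿ S_n'`. -/
theorem deriv_dS {z : ℂ} (hz : s₀ z ≠ 0) (n : ℕ) :
    deriv (dS s₀ n) z =
      -∑ p ∈ antidiagonal (n + 1), dS s₀ p.1 z * dS s₀ p.2 z := by
  have h := dS_recursion s₀ (n + 1) (by omega) z
  rw [Nat.add_sub_cancel] at h
  rw [Finset.Nat.sum_antidiagonal_eq_sum_range_succ (fun i j => dS s₀ i z * dS s₀ j z),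
    Finset.sum_range_succ, ← Finset.sum_range_add_sum_Ico _ (by omega : 1 ≤ n + 1)]
  simp only [Finset.range_one, Finset.sum_singleton, Nat.sub_zero, Nat.sub_self, dS_zero]
  rw [h]
  field_simp
  ring

theorem mul_deriv_dSum {x : ℝ} (hs : AnalyticAt ℂ s₀ x) (h0 : s₀ x ≠ 0) (N : ℕ) (ε : ℝ) :
    ε * deriv (dSum s₀ N ε) x = s₀ x ^ 2 - ∑ m ∈ Finset.range (N + 2),
      (ε : ℂ) ^ m * ∑ p ∈ antidiagonal m, dS s₀ p.1 x * dS s₀ p.2 x := by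
  rw [(hasDerivAt_dSum hs h0 N ε).deriv, Finset.sum_range_succ' _ (N + 1), Finset.mul_sum,
    sub_add_eq_sub_sub_swap]
  simp only [deriv_dS h0, pow_succ]
  simp [dS_zero, mul_assoc, mul_left_comm]

/-- The residual of the truncated expansion `u = dSum s₀ N ε` in the Riccati equation
`u² + ε u' = s₀²`, which is the equation satisfied by `ε w' / w` when `ε² w'' = s₀² w`. -/
noncomputable def riccatiResidual (s₀ : ℂ → ℂ) (N : ℕ) (ε x : ℝ) : ℂ :=
  dSum s₀ N ε x ^ 2 + ε * deriv (dSum s₀ N ε) x - s₀ x ^ 2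

theorem riccatiResidual_eq {x : ℝ} (hs : AnalyticAt ℂ s₀ x) (h0 : s₀ x ≠ 0) (N : ℕ) (ε : ℝ) :
    riccatiResidual s₀ N ε x =
      -(2 * (ε : ℂ) ^ (N + 1) * (s₀ x * dS s₀ (N + 1) x)) +
        ∑ n ∈ Finset.Icc 2 N, (ε : ℂ) ^ (N + n) *
          ∑ k ∈ Finset.Icc n N, dS s₀ k x * dS s₀ (N + n - k) x := by
  set F : ℕ × ℕ → ℂ := fun p => (ε : ℂ) ^ (p.1 + p.2) * (dS s₀ p.1 x * dS s₀ p.2 x) with hF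
  have hsq : dSum s₀ N ε x ^ 2 =
      ∑ p ∈ Finset.range (N + 1) ×ˢ Finset.range (N + 1), F p := by
    rw [sq, dSum, Finset.sum_mul_sum, ← Finset.sum_product']
    refine Finset.sum_congr rfl fun p _ => ?_
    simp only [hF, pow_add]
    ring
  have hdiag : ∀ m, ∑ p ∈ antidiagonal m, F p =
      (ε : ℂ) ^ m * ∑ p ∈ antidiagonal m, dS s₀ p.1 x * dS s₀ p.2 x := fun m => by
    rw [Finset.mul_sum]
    exact Finset.sum_congr rfl fun p hp => by simp only [hF, mem_antidiagonal.1 hp]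
  have hhigh : ∑ n ∈ Finset.Icc 2 N, ∑ k ∈ Finset.Icc n N, F (k, N + n - k) =
      ∑ n ∈ Finset.Icc 2 N, (ε : ℂ) ^ (N + n) *
        ∑ k ∈ Finset.Icc n N, dS s₀ k x * dS s₀ (N + n - k) x :=
    Finset.sum_congr rfl fun n _ => by
      rw [Finset.mul_sum]
      refine Finset.sum_congr rfl fun k hk => ?_
      have hkN : k ≤ N + n := by have := Finset.mem_Icc.1 hk; omega
      simp only [hF, Nat.add_sub_cancel' hkN]
  have hcomb := sum_range_product_eq_sum_antidiagonal N F
  have hcorner : F (0, N + 1) + F (N + 1, 0) =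
      2 * (ε : ℂ) ^ (N + 1) * (s₀ x * dS s₀ (N + 1) x) := by
    simp only [hF, dS_zero, zero_add, add_zero]
    ring
  simp only [riccatiResidual, hsq, mul_deriv_dSum hs h0, ← hdiag, ← hhigh]
  linear_combination hcomb - hcorner

/-- The last factor of `errorBound`: up to the factor `ε M²`, the size of `riccatiResidual`. -/
noncomputable def truncationBound (K : ℝ) (N : ℕ) (ε : ℝ) : ℝ :=
  2 * ε ^ N * K ^ (N + 1) * ((N + 1 : ℕ) : ℝ) ^ (N + 1) +
    ∑ n ∈ Finset.Icc 2 N, ε ^ (N + n - 1) * K ^ (N + n) *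
      ∑ k ∈ Finset.Icc 2 (N + n), (k : ℝ) ^ k * ((N + n - k : ℕ) : ℝ) ^ (N + n - k)

theorem truncationBound_nonneg {K ε : ℝ} (hK : 0 ≤ K) (hε : 0 ≤ ε) (N : ℕ) :
    0 ≤ truncationBound K N ε := by
  unfold truncationBound
  positivity

theorem norm_sum_Icc_mul_le {s : ℕ → ℂ} {M K : ℝ} (hM : 0 ≤ M) (hK : 0 ≤ K)
    (hb : ∀ n : ℕ, ‖s n‖ ≤ M * K ^ n * (n : ℝ) ^ n) {N n : ℕ} (hn : 2 ≤ n) :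
    ‖∑ k ∈ Finset.Icc n N, s k * s (N + n - k)‖ ≤ M ^ 2 * K ^ (N + n) *
      ∑ k ∈ Finset.Icc 2 (N + n), (k : ℝ) ^ k * ((N + n - k : ℕ) : ℝ) ^ (N + n - k) :=
  calc ‖∑ k ∈ Finset.Icc n N, s k * s (N + n - k)‖
      ≤ ∑ k ∈ Finset.Icc n N, M ^ 2 * K ^ (N + n) *
          ((k : ℝ) ^ k * ((N + n - k : ℕ) : ℝ) ^ (N + n - k)) := by
        refine norm_sum_le_of_le _ fun k hk => ?_
        have hkN : k ≤ N + n := by have := Finset.mem_Icc.1 hk; omega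
        calc ‖s k * s (N + n - k)‖
            ≤ M * K ^ k * (k : ℝ) ^ k *
              (M * K ^ (N + n - k) * ((N + n - k : ℕ) : ℝ) ^ (N + n - k)) := by
              rw [norm_mul]
              exact mul_le_mul (hb _) (hb _) (norm_nonneg _) (by positivity)
          _ = _ := by rw [← pow_mul_pow_sub K hkN]; ring
    _ ≤ ∑ k ∈ Finset.Icc 2 (N + n), M ^ 2 * K ^ (N + n) *
          ((k : ℝ) ^ k * ((N + n - k : ℕ) : ℝ) ^ (N + n - k)) :=
        Finset.sum_le_sum_of_subset_of_nonneg (Finset.Icc_subset_Icc hn (Nat.le_add_right N n))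
          fun _ _ _ => by positivity
    _ = _ := (Finset.mul_sum _ _ _).symm

theorem norm_riccatiResidual_le {x M K ε : ℝ} (hs : AnalyticAt ℂ s₀ x) (h0 : s₀ x ≠ 0)
    (hM : 0 ≤ M) (hK : 0 ≤ K) (hε : 0 ≤ ε)
    (hb : ∀ n : ℕ, ‖dS s₀ n x‖ ≤ M * K ^ n * (n : ℝ) ^ n) (N : ℕ) :
    ‖riccatiResidual s₀ N ε x‖ ≤ ε * (M ^ 2 * truncationBound K N ε) := by
  have hnormε : ‖(ε : ℂ)‖ = ε := by rw [Complex.norm_real, Real.norm_of_nonneg hε]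
  have hb0 : ‖s₀ x‖ ≤ M := by simpa [dS_zero] using hb 0
  have hlead : ‖-(2 * (ε : ℂ) ^ (N + 1) * (s₀ x * dS s₀ (N + 1) x))‖ ≤
      ε * (M ^ 2 * (2 * ε ^ N * K ^ (N + 1) * ((N + 1 : ℕ) : ℝ) ^ (N + 1))) := by
    rw [norm_neg, norm_mul, norm_mul, norm_mul, norm_pow, hnormε, Complex.norm_ofNat]
    calc _ ≤ 2 * ε ^ (N + 1) * (M * (M * K ^ (N + 1) * ((N + 1 : ℕ) : ℝ) ^ (N + 1))) := by
          gcongr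
          exact hb (N + 1)
      _ = _ := by ring
  have htail : ∀ n ∈ Finset.Icc 2 N, ‖(ε : ℂ) ^ (N + n) *
      ∑ k ∈ Finset.Icc n N, dS s₀ k x * dS s₀ (N + n - k) x‖ ≤
      ε * (M ^ 2 * (ε ^ (N + n - 1) * K ^ (N + n) *
        ∑ k ∈ Finset.Icc 2 (N + n), (k : ℝ) ^ k * ((N + n - k : ℕ) : ℝ) ^ (N + n - k))) := by
    intro n hn
    have hn := (Finset.mem_Icc.1 hn).1
    rw [norm_mul, norm_pow, hnormε]
    refine (mul_le_mul_of_nonneg_left (norm_sum_Icc_mul_le hM hK hb hn)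
      (by positivity)).trans_eq ?_
    rw [← pow_sub_one_mul (by omega : N + n ≠ 0) ε]
    ring
  rw [riccatiResidual_eq hs h0, truncationBound, mul_add, mul_add, Finset.mul_sum, Finset.mul_sum]
  exact (norm_add_le _ _).trans (add_le_add hlead (norm_sum_le_of_le _ htail))

end Residual

section Size

theorem sum_range_pow_mul_pow_succ_self_le {ε K : ℝ} (hε : 0 ≤ ε) (hK : 0 ≤ K) {N : ℕ}
    (hεN : ε * K * N ≤ 1 / 4) :
    ∑ n ∈ Finset.range N, ε ^ n * (K ^ (n + 1) * ((n + 1 : ℕ) : ℝ) ^ (n + 1)) ≤ 2 * K :=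
  calc ∑ n ∈ Finset.range N, ε ^ n * (K ^ (n + 1) * ((n + 1 : ℕ) : ℝ) ^ (n + 1))
      ≤ ∑ n ∈ Finset.range N, K * (1 / 2 : ℝ) ^ n := by
        refine Finset.sum_le_sum fun n hn => ?_
        have hnN : ((n + 1 : ℕ) : ℝ) ≤ N := by exact_mod_cast Finset.mem_range.1 hn
        have hbase : ε * K * ((n + 1 : ℕ) : ℝ) ≤ 1 / 4 := le_trans (by gcongr) hεN
        have htwo : ((n + 1 : ℕ) : ℝ) ≤ 2 ^ n := by exact_mod_cast Nat.lt_two_pow_self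
        calc ε ^ n * (K ^ (n + 1) * ((n + 1 : ℕ) : ℝ) ^ (n + 1))
            = K * ((ε * K * ((n + 1 : ℕ) : ℝ)) ^ n * ((n + 1 : ℕ) : ℝ)) := by
              simp only [mul_pow, pow_succ]
              ring
          _ ≤ K * ((1 / 4) ^ n * 2 ^ n) := by gcongr
          _ = K * (1 / 2 : ℝ) ^ n := by rw [← mul_pow]; norm_num
    _ = K * ∑ n ∈ Finset.range N, (1 / 2 : ℝ) ^ n := (Finset.mul_sum _ _ _).symm
    _ ≤ K * 2 := by gcongr; exact sum_geometric_two_le N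
    _ = 2 * K := mul_comm _ _

theorem re_S_zero {s₀ : ℂ → ℂ} {ξ η x : ℝ} (hre : ∀ y ∈ Set.Icc ξ η, (s₀ y).re = 0)
    (hx : x ∈ Set.Icc ξ η) : (S s₀ ξ 0 x).re = 0 := by
  have hS : S s₀ ξ 0 x = ((∫ τ in ξ..x, (s₀ τ).im : ℝ) : ℂ) * Complex.I := by
    rw [← intervalIntegral.integral_ofReal, ← intervalIntegral.integral_mul_const, S]
    refine intervalIntegral.integral_congr fun τ hτ => ?_
    rw [Set.uIcc_of_le hx.1] at hτ
    apply Complex.ext <;> simp [dS_zero, hre τ ⟨hτ.1, hτ.2.trans hx.2⟩]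
  rw [hS, Complex.re_ofReal_mul, Complex.I_re, mul_zero]

/-- The singular phase `S_0 / ε` is purely imaginary, so only the terms `n ≥ 1` contribute to
the modulus. -/
theorem norm_expSum_le {s₀ : ℂ → ℂ} {ξ η M K ε x : ℝ} (hM : 0 ≤ M) (hK : 0 ≤ K) (hε : 0 ≤ ε)
    (hre : ∀ y ∈ Set.Icc ξ η, (s₀ y).re = 0)
    (hb : ∀ n : ℕ, ∀ y ∈ Set.Icc ξ η, ‖dS s₀ n y‖ ≤ M * K ^ n * (n : ℝ) ^ n) {N : ℕ}
    (hεN : ε * K * N ≤ 1 / 4) (hx : x ∈ Set.Icc ξ η) :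
    ‖expSum s₀ ξ N ε x‖ ≤ Real.exp ((η - ξ) * M * (2 * K)) := by
  have hL : 0 ≤ η - ξ := sub_nonneg.2 (hx.1.trans hx.2)
  have hphase : ((ε : ℂ) ^ (((0 : ℕ) : ℤ) - 1) * S s₀ ξ 0 x).re = 0 := by
    rw [Nat.cast_zero, zero_sub, zpow_neg_one, ← Complex.ofReal_inv, Complex.re_ofReal_mul,
      re_S_zero hre hx, mul_zero]
  have hterm : ∀ n ∈ Finset.range N, ‖(ε : ℂ) ^ (((n + 1 : ℕ) : ℤ) - 1) * S s₀ ξ (n + 1) x‖ ≤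
      (η - ξ) * M * (ε ^ n * (K ^ (n + 1) * ((n + 1 : ℕ) : ℝ) ^ (n + 1))) := by
    intro n _
    rw [Nat.cast_succ, add_sub_cancel_right, zpow_natCast, norm_mul, norm_pow, Complex.norm_real,
      Real.norm_of_nonneg hε]
    calc ε ^ n * ‖S s₀ ξ (n + 1) x‖
        ≤ ε ^ n * ((η - ξ) * (M * K ^ (n + 1) * ((n + 1 : ℕ) : ℝ) ^ (n + 1))) := by
          gcongr
          exact norm_S_le (hb (n + 1)) hx
      _ = _ := by ring
  rw [expSum, Complex.norm_exp, Real.exp_le_exp, Finset.sum_range_succ', Complex.add_re, hphase,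
    add_zero]
  refine (Complex.re_le_norm _).trans ((norm_sum_le_of_le _ hterm).trans ?_)
  rw [← Finset.mul_sum]
  gcongr
  exact sum_range_pow_mul_pow_succ_self_le hε hK hεN

theorem norm_dSum_le {s₀ : ℂ → ℂ} {M K ε x : ℝ} (hε : 0 ≤ ε)
    (hb : ∀ n : ℕ, ‖dS s₀ n x‖ ≤ M * K ^ n * (n : ℝ) ^ n) (N : ℕ) :
    ‖dSum s₀ N ε x‖ ≤ M * ∑ n ∈ Finset.range (N + 1), ε ^ n * K ^ n * (n : ℝ) ^ n := by
  rw [Finset.mul_sum]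
  refine norm_sum_le_of_le _ fun n _ => ?_
  rw [norm_mul, norm_pow, Complex.norm_real, Real.norm_of_nonneg hε]
  calc ε ^ n * ‖dS s₀ n x‖ ≤ ε ^ n * (M * K ^ n * (n : ℝ) ^ n) := by gcongr; exact hb n
    _ = M * (ε ^ n * K ^ n * (n : ℝ) ^ n) := by ring

theorem norm_mul_dSum_sub_le {s₀ : ℂ → ℂ} {M K ε x : ℝ} (hε : 0 ≤ ε)
    (hb : ∀ n : ℕ, ‖dS s₀ n x‖ ≤ M * K ^ n * (n : ℝ) ^ n) (N : ℕ) (φ₀ φ₁ : ℂ) :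
    ‖φ₀ * dSum s₀ N ε x - φ₁‖ ≤
      ‖φ₀‖ * M * (∑ n ∈ Finset.range (N + 1), ε ^ n * K ^ n * (n : ℝ) ^ n) + ‖φ₁‖ := by
  refine (norm_sub_le _ _).trans ?_
  rw [norm_mul, mul_assoc]
  gcongr
  exact norm_dSum_le hε hb N

theorem norm_denom_sub_le {σ : ℂ → ℂ} {ξ M K ε : ℝ} (hM : 0 ≤ M) (hK : 0 ≤ K) (hε : 0 ≤ ε)
    (hbp : ∀ n : ℕ, ‖dS (sPlus σ) n ξ‖ ≤ M * K ^ n * (n : ℝ) ^ n)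
    (hbm : ∀ n : ℕ, ‖dS (sMinus σ) n ξ‖ ≤ M * K ^ n * (n : ℝ) ^ n) {N : ℕ}
    (hεN : ε * K * N ≤ 1 / 4) :
    ‖denom σ ξ N ε - 2 * Complex.I * σ ξ‖ ≤ 4 * M * K * ε := by
  have hterm : ∀ n ∈ Finset.range N,
      ‖(ε : ℂ) ^ (n + 1) * (dS (sPlus σ) (n + 1) ξ - dS (sMinus σ) (n + 1) ξ)‖ ≤
        2 * M * ε * (ε ^ n * (K ^ (n + 1) * ((n + 1 : ℕ) : ℝ) ^ (n + 1))) := by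
    intro n _
    rw [norm_mul, norm_pow, Complex.norm_real, Real.norm_of_nonneg hε]
    calc _ ≤ ε ^ (n + 1) * (M * K ^ (n + 1) * ((n + 1 : ℕ) : ℝ) ^ (n + 1) +
          M * K ^ (n + 1) * ((n + 1 : ℕ) : ℝ) ^ (n + 1)) := by
          gcongr
          exact (norm_sub_le _ _).trans (add_le_add (hbp _) (hbm _))
      _ = _ := by ring
  have hlead : (ε : ℂ) ^ 0 * (dS (sPlus σ) 0 ξ - dS (sMinus σ) 0 ξ) = 2 * Complex.I * σ ξ := by
    simp only [dS_zero, sPlus, sMinus]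
    ring
  rw [denom, Finset.sum_range_succ', hlead, add_sub_cancel_right]
  calc _ ≤ 2 * M * ε *
        ∑ n ∈ Finset.range N, ε ^ n * (K ^ (n + 1) * ((n + 1 : ℕ) : ℝ) ^ (n + 1)) := by
        rw [Finset.mul_sum]
        exact norm_sum_le_of_le _ hterm
    _ ≤ 2 * M * ε * (2 * K) := by
        gcongr
        exact sum_range_pow_mul_pow_succ_self_le hε hK hεN
    _ = 4 * M * K * ε := by ring

end Size

section Oscillator

variable {F : Type*} [NormedAddCommGroup F] [InnerProductSpace ℝ F]

/-- The left-hand side is the derivative of the energy `ε² ‖e'‖² + s² ‖e‖²` at a point where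
`e`, `e'`, `e''`, `s`, `s'` take the values `e`, `de`, `dde`, `s`, `s'`. -/
theorem energy_deriv_le {m D s s' ε B : ℝ} {e de dde : F} (hm : 0 < m) (hs : m ≤ s)
    (hs' : |s'| ≤ D) (hF : ‖ε ^ 2 • dde + s ^ 2 • e‖ ≤ |ε| * B) :
    ε ^ 2 * (2 * inner ℝ de dde) + (2 * s * s' * ‖e‖ ^ 2 + s ^ 2 * (2 * inner ℝ e de)) ≤
      (1 + 2 * D / m) * (ε ^ 2 * ‖de‖ ^ 2 + s ^ 2 * ‖e‖ ^ 2) + B ^ 2 := by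
  have hD : 0 ≤ D := (abs_nonneg s').trans hs'
  have hs0 : 0 < s := hm.trans_le hs
  have hforce : ε ^ 2 * (2 * inner ℝ de dde) + s ^ 2 * (2 * inner ℝ e de) ≤
      ε ^ 2 * ‖de‖ ^ 2 + B ^ 2 :=
    calc ε ^ 2 * (2 * inner ℝ de dde) + s ^ 2 * (2 * inner ℝ e de)
        = 2 * inner ℝ de (ε ^ 2 • dde + s ^ 2 • e) := by
          rw [inner_add_right, real_inner_smul_right, real_inner_smul_right, real_inner_comm e de]
          ring
      _ ≤ 2 * (‖de‖ * (|ε| * B)) := by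
          gcongr
          exact (real_inner_le_norm _ _).trans (by gcongr)
      _ = 2 * (|ε| * ‖de‖) * B := by ring
      _ ≤ (|ε| * ‖de‖) ^ 2 + B ^ 2 := two_mul_le_add_sq _ _
      _ = ε ^ 2 * ‖de‖ ^ 2 + B ^ 2 := by rw [mul_pow, sq_abs]
  have hcoef : 2 * s * s' * ‖e‖ ^ 2 ≤ 2 * D / m * (s ^ 2 * ‖e‖ ^ 2) :=
    calc 2 * s * s' * ‖e‖ ^ 2 ≤ 2 * s * D * ‖e‖ ^ 2 := by
          gcongr
          exact (le_abs_self _).trans hs'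
      _ = 2 * D / m * (s * m * ‖e‖ ^ 2) := by field_simp
      _ ≤ 2 * D / m * (s * s * ‖e‖ ^ 2) := by gcongr
      _ = 2 * D / m * (s ^ 2 * ‖e‖ ^ 2) := by ring
  have hkin : 0 ≤ 2 * D / m * (ε ^ 2 * ‖de‖ ^ 2) := by positivity
  have hpot : 0 ≤ s ^ 2 * ‖e‖ ^ 2 := by positivity
  linarith

variable {ξ η m D ε B : ℝ} {s s' : ℝ → ℝ} {e de dde : ℝ → F}

theorem energy_le (hm : 0 < m)
    (hs : ∀ x ∈ Set.Icc ξ η, HasDerivWithinAt s (s' x) (Set.Icc ξ η) x)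
    (hsm : ∀ x ∈ Set.Icc ξ η, m ≤ s x) (hsD : ∀ x ∈ Set.Icc ξ η, |s' x| ≤ D)
    (he : ∀ x ∈ Set.Icc ξ η, HasDerivWithinAt e (de x) (Set.Icc ξ η) x)
    (hde : ∀ x ∈ Set.Icc ξ η, HasDerivWithinAt de (dde x) (Set.Icc ξ η) x)
    (hF : ∀ x ∈ Set.Icc ξ η, ‖ε ^ 2 • dde x + s x ^ 2 • e x‖ ≤ |ε| * B)
    (he0 : e ξ = 0) (hde0 : de ξ = 0) {x : ℝ} (hx : x ∈ Set.Icc ξ η) :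
    ε ^ 2 * ‖de x‖ ^ 2 + s x ^ 2 * ‖e x‖ ^ 2 ≤
      Real.exp ((1 + 2 * D / m) * (η - ξ)) * B ^ 2 := by
  set E : ℝ → ℝ := fun x => ε ^ 2 * ‖de x‖ ^ 2 + s x ^ 2 * ‖e x‖ ^ 2
  set E' : ℝ → ℝ := fun x => ε ^ 2 * (2 * inner ℝ (de x) (dde x)) +
    (2 * s x * s' x * ‖e x‖ ^ 2 + s x ^ 2 * (2 * inner ℝ (e x) (de x))) with hE'
  have hD : 0 ≤ D := (abs_nonneg _).trans (hsD x hx)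
  have hk : 1 ≤ 1 + 2 * D / m := le_add_of_nonneg_right (by positivity)
  have hE : ∀ y ∈ Set.Icc ξ η, HasDerivWithinAt E (E' y) (Set.Icc ξ η) y := fun y hy => by
    refine (((hde y hy).norm_sq.const_mul (ε ^ 2)).add
      (((hs y hy).pow 2).mul (he y hy).norm_sq)).congr_deriv ?_
    simp [hE']
  have hgronwall := le_gronwallBound_of_liminf_deriv_right_le (f := E) (f' := E') (δ := 0)
    (K := 1 + 2 * D / m) (ε := B ^ 2) (fun y hy => (hE y hy).continuousWithinAt)
    (fun y hy r hr => ((hE y ⟨hy.1, hy.2.le⟩).mono_of_mem_nhdsWithin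
      (Icc_mem_nhdsGE_of_mem hy)).liminf_right_slope_le hr)
    (by simp [E, he0, hde0])
    (fun y hy => energy_deriv_le hm (hsm y ⟨hy.1, hy.2.le⟩) (hsD y ⟨hy.1, hy.2.le⟩)
      (hF y ⟨hy.1, hy.2.le⟩)) x hx
  rw [gronwallBound_of_K_ne_0 (by positivity)] at hgronwall
  simp only [zero_mul, zero_add] at hgronwall
  calc E x ≤ B ^ 2 / (1 + 2 * D / m) * (Real.exp ((1 + 2 * D / m) * (x - ξ)) - 1) := hgronwall
    _ ≤ B ^ 2 / 1 * Real.exp ((1 + 2 * D / m) * (η - ξ)) := by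
        gcongr
        · exact sub_nonneg.2 (Real.one_le_exp (mul_nonneg (by positivity) (sub_nonneg.2 hx.1)))
        · refine (sub_le_self _ zero_le_one).trans (Real.exp_le_exp.2 ?_)
          gcongr
          exact hx.2
    _ = Real.exp ((1 + 2 * D / m) * (η - ξ)) * B ^ 2 := by ring

/-- The force is measured against `|ε|`: this is what makes the bound on `e` uniform in `ε`. -/
theorem norm_le_of_oscillator (hm : 0 < m)
    (hs : ∀ x ∈ Set.Icc ξ η, HasDerivWithinAt s (s' x) (Set.Icc ξ η) x)
    (hsm : ∀ x ∈ Set.Icc ξ η, m ≤ s x) (hsD : ∀ x ∈ Set.Icc ξ η, |s' x| ≤ D)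
    (he : ∀ x ∈ Set.Icc ξ η, HasDerivWithinAt e (de x) (Set.Icc ξ η) x)
    (hde : ∀ x ∈ Set.Icc ξ η, HasDerivWithinAt de (dde x) (Set.Icc ξ η) x) (hB : 0 ≤ B)
    (hF : ∀ x ∈ Set.Icc ξ η, ‖ε ^ 2 • dde x + s x ^ 2 • e x‖ ≤ |ε| * B)
    (he0 : e ξ = 0) (hde0 : de ξ = 0) {x : ℝ} (hx : x ∈ Set.Icc ξ η) :
    ‖e x‖ ≤ √(Real.exp ((1 + 2 * D / m) * (η - ξ))) / m * B := by
  have hsq : (m * ‖e x‖) ^ 2 ≤ Real.exp ((1 + 2 * D / m) * (η - ξ)) * B ^ 2 :=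
    calc (m * ‖e x‖) ^ 2 ≤ (s x * ‖e x‖) ^ 2 := by gcongr; exact hsm x hx
      _ = s x ^ 2 * ‖e x‖ ^ 2 := mul_pow _ _ _
      _ ≤ ε ^ 2 * ‖de x‖ ^ 2 + s x ^ 2 * ‖e x‖ ^ 2 := le_add_of_nonneg_left (by positivity)
      _ ≤ _ := energy_le hm hs hsm hsD he hde hF he0 hde0 hx
  have hroot := Real.le_sqrt_of_sq_le hsq
  rw [Real.sqrt_mul' _ (sq_nonneg B), Real.sqrt_sq hB] at hroot
  rwa [div_mul_eq_mul_div, le_div_iff₀' hm]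

end Oscillator

section Approximation

theorem sPlus_sq (σ : ℂ → ℂ) (z : ℂ) : sPlus σ z ^ 2 = -σ z ^ 2 := by
  rw [sPlus, mul_pow, Complex.I_sq, neg_one_mul]

theorem sMinus_sq (σ : ℂ → ℂ) (z : ℂ) : sMinus σ z ^ 2 = -σ z ^ 2 := by
  rw [sMinus, mul_pow, neg_sq, Complex.I_sq, neg_one_mul]

theorem expSum_left (s₀ : ℂ → ℂ) (ξ : ℝ) (N : ℕ) (ε : ℝ) : expSum s₀ ξ N ε ξ = 1 := by
  simp [expSum, S]

theorem denom_eq_sub (σ : ℂ → ℂ) (ξ : ℝ) (N : ℕ) (ε : ℝ) :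
    denom σ ξ N ε = dSum (sPlus σ) N ε ξ - dSum (sMinus σ) N ε ξ := by
  simp only [denom, dSum, mul_sub, Finset.sum_sub_distrib]

variable {σ : ℂ → ℂ} {ξ η m M K ε x : ℝ} {N : ℕ} {φ₀ φ₁ : ℂ}

theorem alpha_add_beta (hd : denom σ ξ N ε ≠ 0) :
    alpha σ ξ N ε φ₀ φ₁ + beta σ ξ N ε φ₀ φ₁ = φ₀ := by
  rw [alpha, beta, ← add_div, div_eq_iff hd, denom_eq_sub]
  ring

theorem alpha_mul_add_beta_mul (hd : denom σ ξ N ε ≠ 0) :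
    alpha σ ξ N ε φ₀ φ₁ * dSum (sMinus σ) N ε ξ + beta σ ξ N ε φ₀ φ₁ * dSum (sPlus σ) N ε ξ =
      φ₁ := by
  rw [alpha, beta, div_mul_eq_mul_div, div_mul_eq_mul_div, ← add_div, div_eq_iff hd, denom_eq_sub]
  ring

theorem approx_left (hd : denom σ ξ N ε ≠ 0) : approx σ ξ N ε φ₀ φ₁ ξ = φ₀ := by
  rw [approx, expSum_left, expSum_left, mul_one, mul_one, alpha_add_beta hd]

/-- The derivative `(φ_N^WKB)'` of the WKB approximation. -/
noncomputable def approxDeriv (σ : ℂ → ℂ) (ξ : ℝ) (N : ℕ) (ε : ℝ) (φ₀ φ₁ : ℂ) (x : ℝ) : ℂ :=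
  (ε : ℂ)⁻¹ * (alpha σ ξ N ε φ₀ φ₁ * (dSum (sMinus σ) N ε x * expSum (sMinus σ) ξ N ε x) +
    beta σ ξ N ε φ₀ φ₁ * (dSum (sPlus σ) N ε x * expSum (sPlus σ) ξ N ε x))

/-- The residual `ε² (φ_N^WKB)'' + σ² φ_N^WKB` of the WKB approximation, written through the
Riccati residuals of its two phases. -/
noncomputable def approxResidual (σ : ℂ → ℂ) (ξ : ℝ) (N : ℕ) (ε : ℝ) (φ₀ φ₁ : ℂ) (x : ℝ) : ℂ :=
  alpha σ ξ N ε φ₀ φ₁ * (riccatiResidual (sMinus σ) N ε x * expSum (sMinus σ) ξ N ε x) +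
    beta σ ξ N ε φ₀ φ₁ * (riccatiResidual (sPlus σ) N ε x * expSum (sPlus σ) ξ N ε x)

theorem approxDeriv_left (hd : denom σ ξ N ε ≠ 0) :
    approxDeriv σ ξ N ε φ₀ φ₁ ξ = (ε : ℂ)⁻¹ * φ₁ := by
  rw [approxDeriv, expSum_left, expSum_left, mul_one, mul_one, alpha_mul_add_beta_mul hd]

theorem hasDerivAt_dSum_mul_expSum {s₀ : ℂ → ℂ} (hs : ∀ y ∈ Set.Icc ξ η, AnalyticAt ℂ s₀ y)
    (h0 : ∀ y ∈ Set.Icc ξ η, s₀ y ≠ 0) (N : ℕ) (hε : ε ≠ 0) (hx : x ∈ Set.Icc ξ η) :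
    HasDerivAt (fun y => dSum s₀ N ε y * expSum s₀ ξ N ε y)
      ((ε : ℂ)⁻¹ * ((s₀ x ^ 2 + riccatiResidual s₀ N ε x) * expSum s₀ ξ N ε x)) x := by
  refine ((hasDerivAt_dSum (hs x hx) (h0 x hx) N ε).differentiableAt.hasDerivAt.mul
    (hasDerivAt_expSum hs h0 N hε hx)).congr_deriv ?_
  rw [riccatiResidual]
  field_simp [Complex.ofReal_ne_zero.2 hε]
  ring

/-- Regularity of the phase `σ = √a` on `[ξ, η]`, the setting of the error estimate: `σ` is
analytic, real and at least `m > 0`, and the derivatives of both WKB sequences grow at most like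
`M Kⁿ nⁿ`. -/
structure RegularPhase (σ : ℂ → ℂ) (ξ η m M K : ℝ) : Prop where
  left_mem : ξ ∈ Set.Icc ξ η
  pos : 0 < m
  nonneg : 0 ≤ K
  analyticAt : ∀ x ∈ Set.Icc ξ η, AnalyticAt ℂ σ x
  im_eq_zero : ∀ x ∈ Set.Icc ξ η, (σ x).im = 0
  le_re : ∀ x ∈ Set.Icc ξ η, m ≤ (σ x).re
  norm_dS_sPlus_le : ∀ n : ℕ, ∀ x ∈ Set.Icc ξ η, ‖dS (sPlus σ) n x‖ ≤ M * K ^ n * (n : ℝ) ^ n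
  norm_dS_sMinus_le : ∀ n : ℕ, ∀ x ∈ Set.Icc ξ η, ‖dS (sMinus σ) n x‖ ≤ M * K ^ n * (n : ℝ) ^ n

namespace RegularPhase

theorem le_norm (h : RegularPhase σ ξ η m M K) (hx : x ∈ Set.Icc ξ η) : m ≤ ‖σ x‖ :=
  (h.le_re x hx).trans (Complex.re_le_norm _)

theorem ne_zero (h : RegularPhase σ ξ η m M K) (hx : x ∈ Set.Icc ξ η) : σ x ≠ 0 :=
  norm_pos_iff.1 (h.pos.trans_le (h.le_norm hx))

theorem re_sq (h : RegularPhase σ ξ η m M K) (hx : x ∈ Set.Icc ξ η) :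
    (((σ x).re ^ 2 : ℝ) : ℂ) = σ x ^ 2 := by
  rw [Complex.ofReal_pow]
  congr 1
  exact Complex.ext rfl (h.im_eq_zero x hx).symm

theorem bound_pos (h : RegularPhase σ ξ η m M K) : 0 < M := by
  have hM := h.norm_dS_sPlus_le 0 ξ h.left_mem
  rw [dS_zero, sPlus, norm_mul, Complex.norm_I, one_mul, pow_zero, pow_zero, mul_one, mul_one] at hM
  exact h.pos.trans_le ((h.le_norm h.left_mem).trans hM)

theorem analyticAt_sPlus (h : RegularPhase σ ξ η m M K) (x : ℝ) (hx : x ∈ Set.Icc ξ η) :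
    AnalyticAt ℂ (sPlus σ) x :=
  analyticAt_const.mul (h.analyticAt x hx)

theorem analyticAt_sMinus (h : RegularPhase σ ξ η m M K) (x : ℝ) (hx : x ∈ Set.Icc ξ η) :
    AnalyticAt ℂ (sMinus σ) x :=
  analyticAt_const.mul (h.analyticAt x hx)

theorem sPlus_ne_zero (h : RegularPhase σ ξ η m M K) (x : ℝ) (hx : x ∈ Set.Icc ξ η) :
    sPlus σ x ≠ 0 :=
  mul_ne_zero Complex.I_ne_zero (h.ne_zero hx)

theorem sMinus_ne_zero (h : RegularPhase σ ξ η m M K) (x : ℝ) (hx : x ∈ Set.Icc ξ η) :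
    sMinus σ x ≠ 0 :=
  mul_ne_zero (neg_ne_zero.2 Complex.I_ne_zero) (h.ne_zero hx)

theorem norm_expSum_sPlus_le (h : RegularPhase σ ξ η m M K) (hε : 0 ≤ ε)
    (hεN : ε * K * N ≤ 1 / 4) (hx : x ∈ Set.Icc ξ η) :
    ‖expSum (sPlus σ) ξ N ε x‖ ≤ Real.exp ((η - ξ) * M * (2 * K)) :=
  norm_expSum_le h.bound_pos.le h.nonneg hε (fun y hy => by simp [sPlus, h.im_eq_zero y hy])
    h.norm_dS_sPlus_le hεN hx

theorem norm_expSum_sMinus_le (h : RegularPhase σ ξ η m M K) (hε : 0 ≤ ε)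
    (hεN : ε * K * N ≤ 1 / 4) (hx : x ∈ Set.Icc ξ η) :
    ‖expSum (sMinus σ) ξ N ε x‖ ≤ Real.exp ((η - ξ) * M * (2 * K)) :=
  norm_expSum_le h.bound_pos.le h.nonneg hε (fun y hy => by simp [sMinus, h.im_eq_zero y hy])
    h.norm_dS_sMinus_le hεN hx

theorem hasDerivAt_approx (h : RegularPhase σ ξ η m M K) (hε : ε ≠ 0) (hx : x ∈ Set.Icc ξ η) :
    HasDerivAt (approx σ ξ N ε φ₀ φ₁) (approxDeriv σ ξ N ε φ₀ φ₁ x) x := by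
  refine (((hasDerivAt_expSum h.analyticAt_sMinus h.sMinus_ne_zero N hε hx).const_mul _).add
    ((hasDerivAt_expSum h.analyticAt_sPlus h.sPlus_ne_zero N hε hx).const_mul _)).congr_deriv ?_
  rw [approxDeriv]
  ring

theorem hasDerivAt_approxDeriv (h : RegularPhase σ ξ η m M K) (hε : ε ≠ 0)
    (hx : x ∈ Set.Icc ξ η) :
    HasDerivAt (approxDeriv σ ξ N ε φ₀ φ₁) (((ε : ℂ) ^ 2)⁻¹ *
      (approxResidual σ ξ N ε φ₀ φ₁ x - σ x ^ 2 * approx σ ξ N ε φ₀ φ₁ x)) x := by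
  refine ((((hasDerivAt_dSum_mul_expSum h.analyticAt_sMinus h.sMinus_ne_zero N hε hx).const_mul
    _).add ((hasDerivAt_dSum_mul_expSum h.analyticAt_sPlus h.sPlus_ne_zero N hε hx).const_mul
    _)).const_mul _).congr_deriv ?_
  rw [approxResidual, approx, sMinus_sq, sPlus_sq]
  ring

theorem le_norm_denom (h : RegularPhase σ ξ η m M K) (hε : 0 ≤ ε) (hεN : ε * K * N ≤ 1 / 4)
    (hεm : 4 * M * K * ε ≤ m) : m ≤ ‖denom σ ξ N ε‖ := by
  have hlead : ‖2 * Complex.I * σ ξ‖ = 2 * ‖σ ξ‖ := by simp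
  have hdiff := norm_denom_sub_le h.bound_pos.le h.nonneg hε
    (fun n => h.norm_dS_sPlus_le n ξ h.left_mem) (fun n => h.norm_dS_sMinus_le n ξ h.left_mem) hεN
  have htri := norm_sub_norm_le (2 * Complex.I * σ ξ) (denom σ ξ N ε)
  rw [norm_sub_rev, hlead] at htri
  linarith [h.le_norm h.left_mem]

theorem norm_alpha_le (h : RegularPhase σ ξ η m M K) (hε : 0 ≤ ε)
    (hd : m ≤ ‖denom σ ξ N ε‖) :
    ‖alpha σ ξ N ε φ₀ φ₁‖ ≤
      (‖φ₀‖ * M * (∑ n ∈ Finset.range (N + 1), ε ^ n * K ^ n * (n : ℝ) ^ n) + ‖φ₁‖) / m := by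
  have hnum := norm_mul_dSum_sub_le hε (fun n => h.norm_dS_sPlus_le n ξ h.left_mem) N φ₀ φ₁
  rw [alpha, norm_div]
  exact div_le_div₀ ((norm_nonneg _).trans hnum) hnum h.pos hd

theorem norm_beta_le (h : RegularPhase σ ξ η m M K) (hε : 0 ≤ ε)
    (hd : m ≤ ‖denom σ ξ N ε‖) :
    ‖beta σ ξ N ε φ₀ φ₁‖ ≤
      (‖φ₀‖ * M * (∑ n ∈ Finset.range (N + 1), ε ^ n * K ^ n * (n : ℝ) ^ n) + ‖φ₁‖) / m := by
  have hnum := norm_mul_dSum_sub_le hε (fun n => h.norm_dS_sMinus_le n ξ h.left_mem) N φ₀ φ₁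
  rw [beta, norm_div, norm_sub_rev]
  exact div_le_div₀ ((norm_nonneg _).trans hnum) hnum h.pos hd

theorem norm_approxResidual_le (h : RegularPhase σ ξ η m M K) (hε : 0 ≤ ε)
    (hεN : ε * K * N ≤ 1 / 4) (hεm : 4 * M * K * ε ≤ m) (hx : x ∈ Set.Icc ξ η) :
    ‖approxResidual σ ξ N ε φ₀ φ₁ x‖ ≤ ε * (2 * Real.exp ((η - ξ) * M * (2 * K)) / m * M ^ 2 *
      (‖φ₀‖ * M * (∑ n ∈ Finset.range (N + 1), ε ^ n * K ^ n * (n : ℝ) ^ n) + ‖φ₁‖) *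
      truncationBound K N ε) := by
  have hd := h.le_norm_denom hε hεN hεm
  have hT := truncationBound_nonneg h.nonneg hε N
  have hα := h.norm_alpha_le hε hd (φ₀ := φ₀) (φ₁ := φ₁)
  have hβ := h.norm_beta_le hε hd (φ₀ := φ₀) (φ₁ := φ₁)
  set P := ‖φ₀‖ * M * (∑ n ∈ Finset.range (N + 1), ε ^ n * K ^ n * (n : ℝ) ^ n) + ‖φ₁‖
  set W := Real.exp ((η - ξ) * M * (2 * K))
  set T := truncationBound K N ε
  have hP : 0 ≤ P / m := (norm_nonneg _).trans hα
  have hmode : ∀ {c r w : ℂ}, ‖c‖ ≤ P / m → ‖r‖ ≤ ε * (M ^ 2 * T) → ‖w‖ ≤ W →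
      ‖c * (r * w)‖ ≤ P / m * (ε * (M ^ 2 * T) * W) := fun hc hr hw => by
    rw [norm_mul, norm_mul]
    gcongr
  calc ‖approxResidual σ ξ N ε φ₀ φ₁ x‖
      ≤ P / m * (ε * (M ^ 2 * T) * W) + P / m * (ε * (M ^ 2 * T) * W) :=
        (norm_add_le _ _).trans (add_le_add
          (hmode hα (norm_riccatiResidual_le (h.analyticAt_sMinus x hx) (h.sMinus_ne_zero x hx)
            h.bound_pos.le h.nonneg hε (fun n => h.norm_dS_sMinus_le n x hx) N)
            (h.norm_expSum_sMinus_le hε hεN hx))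
          (hmode hβ (norm_riccatiResidual_le (h.analyticAt_sPlus x hx) (h.sPlus_ne_zero x hx)
            h.bound_pos.le h.nonneg hε (fun n => h.norm_dS_sPlus_le n x hx) N)
            (h.norm_expSum_sPlus_le hε hεN hx)))
    _ = ε * (2 * W / m * M ^ 2 * P * T) := by ring

theorem norm_sub_approx_le (h : RegularPhase σ ξ η m M K) {D : ℝ}
    (hD : ∀ x ∈ Set.Icc ξ η, ‖deriv σ x‖ ≤ D) (hε : 0 < ε) (hεN : ε * K * N ≤ 1 / 4)
    (hεm : 4 * M * K * ε ≤ m) {a : ℝ → ℝ} (ha : ∀ x ∈ Set.Icc ξ η, (a x : ℂ) = σ x ^ 2)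
    {φ : ℝ → ℂ} (hφ : IsSolution a ξ η ε φ₀ φ₁ φ) (hx : x ∈ Set.Icc ξ η) :
    ‖φ x - approx σ ξ N ε φ₀ φ₁ x‖ ≤ √(Real.exp ((1 + 2 * D / m) * (η - ξ))) / m *
      (2 * Real.exp ((η - ξ) * M * (2 * K)) / m * M ^ 2 *
        (‖φ₀‖ * M * (∑ n ∈ Finset.range (N + 1), ε ^ n * K ^ n * (n : ℝ) ^ n) + ‖φ₁‖) *
        truncationBound K N ε) := by
  obtain ⟨dφ, ddφ, hdφ, hddφ, hode, hφ0, hφ1⟩ := hφ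
  have hεc : (ε : ℂ) ≠ 0 := Complex.ofReal_ne_zero.2 hε.ne'
  have hd : denom σ ξ N ε ≠ 0 :=
    norm_pos_iff.1 (h.pos.trans_le (h.le_norm_denom hε.le hεN hεm))
  have hres : ∀ y ∈ Set.Icc ξ η, ε ^ 2 • (ddφ y - ((ε : ℂ) ^ 2)⁻¹ *
      (approxResidual σ ξ N ε φ₀ φ₁ y - σ y ^ 2 * approx σ ξ N ε φ₀ φ₁ y)) +
      (σ y).re ^ 2 • (φ y - approx σ ξ N ε φ₀ φ₁ y) = -approxResidual σ ξ N ε φ₀ φ₁ y := by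
    intro y hy
    have hy_ode := hode y hy
    rw [ha y hy] at hy_ode
    rw [Complex.real_smul, Complex.real_smul, h.re_sq hy, Complex.ofReal_pow]
    field_simp
    linear_combination hy_ode
  have hM := h.bound_pos
  have hT := truncationBound_nonneg h.nonneg hε.le N
  have hm := h.pos
  have hK := h.nonneg
  refine norm_le_of_oscillator (ε := ε) (s := fun x : ℝ => (σ x).re)
    (s' := fun x : ℝ => (deriv σ x).re) h.pos
    (fun y hy => (h.analyticAt y hy).differentiableAt.hasDerivAt.real_of_complex.hasDerivWithinAt)
    h.le_re (fun y hy => (Complex.abs_re_le_norm _).trans (hD y hy))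
    (fun y hy => (hdφ y hy).sub (h.hasDerivAt_approx hε.ne' hy).hasDerivWithinAt)
    (fun y hy => (hddφ y hy).sub (h.hasDerivAt_approxDeriv hε.ne' hy).hasDerivWithinAt)
    (by positivity) (fun y hy => ?_) ?_ ?_ hx
  · rw [Pi.sub_apply, hres y hy, norm_neg, abs_of_pos hε]
    exact h.norm_approxResidual_le hε.le hεN hεm hy
  · rw [Pi.sub_apply, hφ0, approx_left hd, sub_self]
  · rw [approxDeriv_left hd, ← hφ1, inv_mul_cancel_left₀ hεc, sub_self]

end RegularPhase

end Approximation

section ErrorBound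

variable {σ : ℂ → ℂ} {ξ η m M K : ℝ}

theorem le_errorBound {C L ε p q : ℝ} {N : ℕ} (hC : 0 ≤ C) (hL : 0 ≤ L) (hM : 0 ≤ M) (hK : 0 ≤ K)
    (hε : 0 ≤ ε) (hp : 0 ≤ p) (hq : 0 ≤ q) :
    C * M ^ 2 * (p * M * (∑ n ∈ Finset.range (N + 1), ε ^ n * K ^ n * (n : ℝ) ^ n) + q) *
      truncationBound K N ε ≤ errorBound C L M K N ε p q := by
  refine mul_le_mul_of_nonneg_right ?_ (truncationBound_nonneg hK hε N)
  exact le_mul_of_one_le_right (by positivity) (Real.one_le_exp (by positivity))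

theorem exists_uniform_smallness (hM : 0 < M) (hK : 0 < K) (hm : 0 < m) :
    ∃ c : ℝ, 0 < c ∧ ∀ N : ℕ, c / (N + 1) < 1 ∧
      ∀ ε : ℝ, 0 ≤ ε → ε ≤ c / (N + 1) → ε * K * N ≤ 1 / 4 ∧ 4 * M * K * ε ≤ m := by
  refine ⟨min (1 / 2) (min (1 / (4 * K)) (m / (4 * M * K))), by positivity, fun N => ⟨?_, ?_⟩⟩
  · rw [div_lt_one (by positivity)]
    exact (min_le_left _ _).trans_lt (by linarith [(N.cast_nonneg : (0 : ℝ) ≤ N)])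
  · intro ε hε hεN
    have hc := (le_div_iff₀ (by positivity)).1 hεN
    have hquarter : ε * (N + 1) ≤ 1 / (4 * K) :=
      hc.trans ((min_le_right _ _).trans (min_le_left _ _))
    have hdenom : ε * (N + 1) ≤ m / (4 * M * K) :=
      hc.trans ((min_le_right _ _).trans (min_le_right _ _))
    rw [le_div_iff₀ (by positivity)] at hquarter hdenom
    have hN : 0 ≤ ε * N * (M * K) := by positivity
    constructor <;> nlinarith [mul_nonneg hε hK.le]

theorem RegularPhase.exists_errorBound (h : RegularPhase σ ξ η m M K) (hK : 0 < K) {a : ℝ → ℝ}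
    (ha : ∀ x ∈ Set.Icc ξ η, (a x : ℂ) = σ x ^ 2) :
    ∃ C : ℝ, 0 < C ∧ ∃ ε₀ : ℕ → ℝ, (∀ N : ℕ, 0 < ε₀ N ∧ ε₀ N < 1) ∧
      (∃ c : ℝ, 0 < c ∧ ∀ N : ℕ, c / (N + 1) ≤ ε₀ N) ∧
      ∀ N : ℕ, ∀ ε : ℝ, 0 < ε → ε ≤ ε₀ N → denom σ ξ N ε ≠ 0 ∧
        ∀ (φ₀ φ₁ : ℂ) (φ : ℝ → ℂ), IsSolution a ξ η ε φ₀ φ₁ φ →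
          LInf (Set.Icc ξ η) (fun x => φ x - approx σ ξ N ε φ₀ φ₁ x) ≤
            ENNReal.ofReal (errorBound C (η - ξ) M K N ε ‖φ₀‖ ‖φ₁‖) := by
  have hm := h.pos
  obtain ⟨D, hD⟩ := isCompact_Icc.exists_bound_of_continuousOn (f := fun x : ℝ => deriv σ x)
    fun x hx => ((h.analyticAt x hx).deriv.continuousAt.comp
      Complex.continuous_ofReal.continuousAt).continuousWithinAt
  obtain ⟨c, hc, hsmall⟩ := exists_uniform_smallness h.bound_pos hK hm
  set A := √(Real.exp ((1 + 2 * D / m) * (η - ξ))) / m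
  set B := 2 * Real.exp ((η - ξ) * M * (2 * K)) / m
  refine ⟨A * B, by positivity, fun N => c / (N + 1), fun N => ⟨by positivity, (hsmall N).1⟩,
    ⟨c, hc, fun _ => le_rfl⟩, fun N ε hε hεN => ?_⟩
  obtain ⟨hquarter, hdenom⟩ := (hsmall N).2 ε hε.le hεN
  refine ⟨norm_pos_iff.1 (hm.trans_le (h.le_norm_denom hε.le hquarter hdenom)),
    fun φ₀ φ₁ φ hφ => LInf_le_of_forall_norm_le measurableSet_Icc fun x hx => ?_⟩
  refine (h.norm_sub_approx_le hD hε hquarter hdenom ha hφ hx).trans ?_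
  rw [← mul_assoc, ← mul_assoc, ← mul_assoc]
  exact le_errorBound (by positivity) (sub_nonneg.2 (hx.1.trans hx.2)) h.bound_pos.le hK.le hε.le
    (norm_nonneg _) (norm_nonneg _)

theorem RegularPhase.of_admissibleConstants {K₁ K₂ : ℝ} (hξη : ξ < η) (hm : 0 < m)
    (hσ : ∀ x ∈ Set.Icc ξ η, AnalyticAt ℂ σ x) (him : ∀ x ∈ Set.Icc ξ η, (σ x).im = 0)
    (hre : ∀ x ∈ Set.Icc ξ η, m ≤ (σ x).re) (hM : 0 ≤ M)
    (hK : AdmissibleConstants σ ξ η M K₁ K₂) : RegularPhase σ ξ η m M K₂ := by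
  obtain ⟨-, hK₂, hminus, hplus⟩ := hK
  have h0 : ∀ x ∈ Set.Icc ξ η, σ x ≠ 0 := fun x hx =>
    norm_pos_iff.1 (hm.trans_le ((hre x hx).trans (Complex.re_le_norm _)))
  exact
    { left_mem := Set.left_mem_Icc.2 hξη.le
      pos := hm
      nonneg := hK₂.le
      analyticAt := hσ
      im_eq_zero := him
      le_re := hre
      norm_dS_sPlus_le := fun n x hx => norm_dS_le_of_estimates hξη hM hK₂.le
        (fun y hy => analyticAt_const.mul (hσ y hy))
        (fun y hy => mul_ne_zero Complex.I_ne_zero (h0 y hy)) hplus n hx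
      norm_dS_sMinus_le := fun n x hx => norm_dS_le_of_estimates hξη hM hK₂.le
        (fun y hy => analyticAt_const.mul (hσ y hy))
        (fun y hy => mul_ne_zero (neg_ne_zero.2 Complex.I_ne_zero) (h0 y hy)) hminus n hx }

theorem norm_le_toReal_LInf_sPlus {G : Set ℂ} (hG : IsOpen G) (hσ : ContinuousOn σ G)
    (hb : Bornology.IsBounded (σ '' G)) {z : ℂ} (hz : z ∈ G) :
    ‖σ z‖ ≤ (LInf G (sPlus σ)).toReal := by
  obtain ⟨B, hB⟩ := hb.exists_norm_le
  have hb' : Bornology.IsBounded (sPlus σ '' G) :=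
    isBounded_iff_forall_norm_le.2 ⟨B, Set.forall_mem_image.2 fun w hw => by
      simpa [sPlus] using hB _ (Set.mem_image_of_mem σ hw)⟩
  have hcont : ContinuousOn (sPlus σ) G := continuousOn_const.mul hσ
  simpa [sPlus] using norm_le_toReal_LInf hG hcont hb' hz

end ErrorBound

section Asymptotics

open Asymptotics Filter Topology

theorem truncationBound_isBigO (K : ℝ) (N : ℕ) :
    truncationBound K N =O[𝓝 0] fun ε => ε ^ N := by
  have hquot : Continuous fun ε : ℝ => 2 * K ^ (N + 1) * ((N + 1 : ℕ) : ℝ) ^ (N + 1) +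
      ∑ n ∈ Finset.Icc 2 N, ε ^ (n - 1) * K ^ (N + n) *
        ∑ k ∈ Finset.Icc 2 (N + n), (k : ℝ) ^ k * ((N + n - k : ℕ) : ℝ) ^ (N + n - k) := by
    fun_prop
  refine ((hquot.continuousAt.tendsto.isBigO_one ℝ).mul (isBigO_refl (fun ε : ℝ => ε ^ N) _)).congr
    (fun ε => ?_) fun _ => one_mul _
  rw [truncationBound, add_mul, Finset.sum_mul]
  congr 1
  · ring
  · refine Finset.sum_congr rfl fun n hn => ?_
    rw [Nat.add_sub_assoc (by linarith [(Finset.mem_Icc.1 hn).1]), pow_add]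
    ring

theorem errorBound_isBigO (C L M K : ℝ) (N : ℕ) (p q : ℝ) :
    (fun ε => errorBound C L M K N ε p q) =O[𝓝 0] fun ε => ε ^ N := by
  have hprefix : Continuous fun ε : ℝ => C * M ^ 2 *
      (p * M * (∑ n ∈ Finset.range (N + 1), ε ^ n * K ^ n * (n : ℝ) ^ n) + q) *
      Real.exp (L * M * ∑ n ∈ Finset.range (N / 2 + 1),
        ε ^ (2 * n) * K ^ (2 * n + 1) * ((2 * n + 1 : ℕ) : ℝ) ^ (2 * n + 1)) := by fun_prop
  exact ((hprefix.continuousAt.tendsto.isBigO_one ℝ).mul (truncationBound_isBigO K N)).congr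
    (fun _ => rfl) fun _ => one_mul _

theorem isBigO_toReal_of_eventually_le {α : Type*} {l : Filter α} {f : α → ℝ≥0∞} {g : α → ℝ}
    (h : ∀ᶠ x in l, f x ≤ ENNReal.ofReal (g x)) : (fun x => (f x).toReal) =O[l] g := by
  refine IsBigO.of_bound' (h.mono fun x hx => ?_)
  rw [Real.norm_of_nonneg ENNReal.toReal_nonneg]
  refine (ENNReal.toReal_mono ENNReal.ofReal_ne_top hx).trans ?_
  rw [ENNReal.toReal_ofReal']
  exact max_le (le_abs_self _) (norm_nonneg _)

end Asymptotics

end WKB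

theorem theorem2
    (ξ η : ℝ) (hξη : ξ < η)
    (a : ℝ → ℝ) (a₀ : ℝ) (ha₀ : 0 < a₀) (ha : ∀ x ∈ Set.Icc ξ η, a₀ ≤ a x)
    -- `G` is a complex neighbourhood of `I = [ξ, η]`
    (G : Set ℂ) (hG : IsOpen G) (hIG : ∀ x ∈ Set.Icc ξ η, (x : ℂ) ∈ G)
    -- `σ` is a bounded analytic extension of `√a` to `G`, so that `S_0' = ± i σ`
    (σ : ℂ → ℂ) (hσ : AnalyticOnNhd ℂ σ G) (hσb : Bornology.IsBounded (σ '' G))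
    (hσa : ∀ x ∈ Set.Icc ξ η, σ (x : ℂ) = (Real.sqrt (a x) : ℂ))
    (M : ℝ) (hM : M = (WKB.LInf G (WKB.sPlus σ)).toReal) :
    (∃ K₁ K₂ : ℝ, WKB.AdmissibleConstants σ ξ η M K₁ K₂) ∧
    (∀ K₁ K₂ : ℝ, WKB.AdmissibleConstants σ ξ η M K₁ K₂ →
      -- `C` is independent of `N`; `ε₀` may depend on `N`, but decays at most like `1 / (N + 1)`
      ∃ C : ℝ, 0 < C ∧ ∃ ε₀ : ℕ → ℝ,
        (∀ N : ℕ, 0 < ε₀ N ∧ ε₀ N < 1) ∧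
        (∃ c : ℝ, 0 < c ∧ ∀ N : ℕ, c / (N + 1) ≤ ε₀ N) ∧
        ∀ N : ℕ, ∀ ε : ℝ, 0 < ε → ε ≤ ε₀ N →
          -- the coefficients `α`, `β` are well defined
          WKB.denom σ ξ N ε ≠ 0 ∧
          ∀ (φ₀ φ₁ : ℂ) (φ : ℝ → ℂ), WKB.IsSolution a ξ η ε φ₀ φ₁ φ →
            WKB.LInf (Set.Icc ξ η) (fun x => φ x - WKB.approx σ ξ N ε φ₀ φ₁ x) ≤
              ENNReal.ofReal (WKB.errorBound C (η - ξ) M K₂ N ε ‖φ₀‖ ‖φ₁‖)) ∧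
    -- in particular, the error is `O(ε ^ N)` for each fixed `N`
    (∀ (φ₀ φ₁ : ℂ) (φ : ℝ → ℝ → ℂ),
      (∀ ε : ℝ, 0 < ε → ε < 1 → WKB.IsSolution a ξ η ε φ₀ φ₁ (φ ε)) →
      ∀ N : ℕ,
        Asymptotics.IsBigO (nhdsWithin (0 : ℝ) (Set.Ioi 0))
          (fun ε : ℝ =>
            (WKB.LInf (Set.Icc ξ η)
              (fun x => φ ε x - WKB.approx σ ξ N ε φ₀ φ₁ x)).toReal)
          (fun ε : ℝ => ε ^ N)) := by
  have hσsq : ∀ x ∈ Set.Icc ξ η, (a x : ℂ) = σ x ^ 2 := fun x hx => by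
    rw [hσa x hx, ← Complex.ofReal_pow, Real.sq_sqrt (ha₀.le.trans (ha x hx))]
  have him : ∀ x ∈ Set.Icc ξ η, (σ x).im = 0 := fun x hx => by
    rw [hσa x hx, Complex.ofReal_im]
  have hre : ∀ x ∈ Set.Icc ξ η, √a₀ ≤ (σ x).re := fun x hx => by
    rw [hσa x hx, Complex.ofReal_re]
    exact Real.sqrt_le_sqrt (ha x hx)
  have hσM : ∀ z ∈ G, ‖σ z‖ ≤ M := fun z hz =>
    hM ▸ WKB.norm_le_toReal_LInf_sPlus hG hσ.continuousOn hσb hz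
  have hadm := WKB.exists_admissibleConstants hξη (Real.sqrt_pos.2 ha₀) hG hIG hσ
    (fun x hx => (hre x hx).trans (Complex.re_le_norm _)) hσM
  have herr := fun K₁ K₂ (hK : WKB.AdmissibleConstants σ ξ η M K₁ K₂) =>
    (WKB.RegularPhase.of_admissibleConstants hξη (Real.sqrt_pos.2 ha₀)
      (fun x hx => hσ x (hIG x hx)) him hre (hM ▸ ENNReal.toReal_nonneg) hK).exists_errorBound
      hK.2.1 hσsq
  refine ⟨hadm, herr, fun φ₀ φ₁ φ hφ N => ?_⟩
  obtain ⟨K₁, K₂, hK⟩ := hadm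
  obtain ⟨C, -, ε₀, hε₀, -, hest⟩ := herr K₁ K₂ hK
  refine (WKB.isBigO_toReal_of_eventually_le ?_).trans
    ((WKB.errorBound_isBigO C (η - ξ) M K₂ N ‖φ₀‖ ‖φ₁‖).mono nhdsWithin_le_nhds)
  filter_upwards [Ioc_mem_nhdsGT (hε₀ N).1] with ε hε
  exact (hest N ε hε.1 hε.2).2 φ₀ φ₁ (φ ε) (hφ ε hε.1 (hε.2.trans_lt (hε₀ N).2))
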